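/- **Setting.** Let $M$ be a manifold with a smooth volume measure and a fixed splitting $M\cong\mathbb R\times N$ with time function $t$ (a globally hyperbolic space-time). A set is *spatially compact* if it meets every slab $\{t'\le t\le t''\}$ in a compact set. $\Gamma_+(X)$ (resp. $\Gamma_-(X)$) denotes the smooth or distributional sections of a vector bundle $X\to M$ with spatially compact support contained in $\{t\ge t_0\}$ (resp. $\{t\le t_0\}$) for some $t_0$; $\Gamma_0$ means compact support. Condensed notation is used: contraction of indices includes integration over $M$. Fields $\varphi$ are the smooth sections of a vector bundle $W\to M$ with values in an open set $U\subset W$; so vector fields on the space $\mathcal M$ of fields take values in $\Gamma(W)$ and 1-forms in $\Gamma(W^*)$. Let $T_a[\varphi]=0$ be local field equations with values in $\Gamma(E)$, $\Sigma$ the set of solutions, $J_{ai}=T_{a,i}$ the Jacobi operator (a linear differential operator), $\approx$ equality on $\Sigma$. Let $R$ be gauge symmetry generators, $J\circ R\approx0$, and $L$ generators of gauge identities, $L^a_AT_a\equiv0$, both differential operators; assume that the on-shell complexes $$\Gamma_\pm(F)\xrightarrow{R}\Gamma_\pm(W)\xrightarrow{J}\Gamma_\pm(E)\xrightarrow{L}\Gamma_\pm(G),\qquad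 \Gamma_\pm(G^*)\xrightarrow{L^*}\Gamma_\pm(E^*)\xrightarrow{J^*}\Gamma_\pm(W^*)\xrightarrow{R^*}\Gamma_\pm(F^*)$$ are exact at their middle terms, for smooth and for distributional sections. Let $V=\{V^i_a\}$ be a Lagrange anchor: differential operators $V[\varphi]:\Gamma(E^*)\to\Gamma(W)$ with $J\circ V\approx V^*\circ J^*$. A *physical observable* is a differentiable functional $A$ of the fields with compactly supported (possibly distributional) derivative $\delta A=A_{,i}$ and $A_{,i}R^i_\alpha\approx0$; it is *regular* if $A_{,i}$ is smooth. An advanced/retarded *fluctuation* of $A$ is a vector field $V_A^\pm\in\Gamma_\pm(W)$ with $V_A^\pm T_a\approx V_aA$; an advanced/retarded *repercussion* of $A$ is $A_\pm\in\Gamma_\pm(E^*)$ with $\delta A\approx A_\pm^a\,\delta T_a$. Put $\{A,B\}^\pm=V_A^\pm B-V_B^\pm A$. Let $A,B$ be observables, $B$ regular; the repercussions and fluctuations of $B$ are taken smooth, those of $A$ may be distributional (so that all contractions are defined). **Claim.** 1. $A$ and $B$ have repercussions $A_\pm$, $B_\pm$ ($B_\pm$ smooth), unique on shell modulo $L^*\Gamma_\pm(G^*)$;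 for any of them $A_\pm^aV_a$ and $B_\pm^aV_a$ are fluctuations caused by $A$ and $B$. 2. (Reciprocity.) For all fluctuations, $V_A^-B\approx V_B^+A$ and $V_B^-A\approx V_A^+B$. 3. Consequently $\{A,B\}^+\approx\{B,A\}^-$, equivalently $\{A,B\}^+\approx-\{A,B\}^-$: the advanced and retarded brackets agree up to sign. Moreover $\{A,B\}^\pm\approx\pm\tilde V_AB$ with $\tilde V_A=(A_+-A_-)^aV_a$, and likewise $\{B,A\}^\pm\approx\pm\tilde V_BA$. 4. Suppose that $E=W^*$ and that $T_i=S_{,i}$ for an action functional $S$ with local density. Then $V=1$ is a Lagrange anchor. Suppose also that on shell there are advanced and retarded Green functions $G^{\pm ij}$ (operators from $\Gamma_0(W^*)$ to smooth sections of $W$ with spatially compact support) with $G^{\pm in}S_{,nj}=S_{,jn}G^{\pm ni}=\delta^i_j$, where $G^{+ij}=0$ if the time of $i$ is later than that of $j$ and $G^{-ij}=0$ if it is earlier. Then, for $V=1$ and any functionals $A,B$ as above (here gauge invariance and exactness need not be assumed), $V_A^{\pm j}\approx A_{,i}G^{\pm ij}$, the vector fields $G^{\mp ij}B_{,j}$ are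 fluctuations $V_B^\pm$, and the brackets are Peierls' brackets $$\{A,B\}^\pm\approx\pm A_{,i}\tilde G^{ij}B_{,j},\qquad \tilde G=G^+-G^-.$$ -/

import Mathlib

open Bundle Manifold Set MeasureTheory
open scoped ContDiff Topology

universe u v w

noncomputable section

/-! ### Smooth vector bundles over the space-time and their sections -/

section Bundles

/-- A smooth real vector bundle of finite rank over the `d`-dimensional manifold `M`: Mathlib's
unbundled notion, with fibres `V x` and model fibre `F`, put into one object. -/
structure VBundle (d : ℕ) (M : Type u) [TopologicalSpace M]
    [ChartedSpace (EuclideanSpace ℝ (Fin d)) M] where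
  F : Type v
  V : M → Type w
  [normF : NormedAddCommGroup F]
  [spaceF : NormedSpace ℝ F]
  [finF : FiniteDimensional ℝ F]
  [addV : ∀ x, AddCommGroup (V x)]
  [modV : ∀ x, Module ℝ (V x)]
  [topV : ∀ x, TopologicalSpace (V x)]
  [topTotal : TopologicalSpace (TotalSpace F V)]
  [fiber : FiberBundle F V]
  [vector : VectorBundle ℝ F V]
  [smooth : ContMDiffVectorBundle ∞ F V (𝓡 d)]

attribute [instance] VBundle.normF VBundle.spaceF VBundle.finF VBundle.addV VBundle.modV
  VBundle.topV VBundle.topTotal VBundle.fiber VBundle.vector VBundle.smooth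

variable {d : ℕ} {M : Type u} [TopologicalSpace M] [ChartedSpace (EuclideanSpace ℝ (Fin d)) M]

/-- The dual bundle `X*`. -/
def VBundle.dual (X : VBundle.{u, v, w} d M) : VBundle.{u, v, w} d M where
  F := X.F →L[ℝ] ℝ
  V := fun x => X.V x →L[ℝ] Bundle.Trivial M ℝ x

/-- The space `Γ(X)` of smooth sections. -/
abbrev VBundle.Γ (X : VBundle.{u, v, w} d M) : Type _ := Cₛ^∞⟮𝓡 d; X.F, X.V⟯

/-- The ring `C^∞(M)`. -/
abbrev SmoothFun (d : ℕ) (M : Type u) [TopologicalSpace M]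
    [ChartedSpace (EuclideanSpace ℝ (Fin d)) M] : Type _ := C^∞⟮𝓡 d, M; 𝓘(ℝ, ℝ), ℝ⟯

variable {X Y Z : VBundle.{u, v, w} d M}

instance : SMul (SmoothFun d M) X.Γ :=
  ⟨fun f s => ⟨fun x => f x • s x, f.contMDiff.smul_section s.contMDiff⟩⟩

theorem VBundle.smul_apply (f : SmoothFun d M) (s : X.Γ) (x : M) : (f • s) x = f x • s x := rfl

instance : Module (SmoothFun d M) X.Γ where
  one_smul s := by ext x; simp [VBundle.smul_apply]
  mul_smul f g s := by ext x; simp [VBundle.smul_apply, mul_smul]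
  smul_zero f := by ext x; simp [VBundle.smul_apply]
  smul_add f s t := by ext x; simp [VBundle.smul_apply]
  add_smul f g s := by ext x; simp [VBundle.smul_apply, add_smul]
  zero_smul s := by ext x; simp [VBundle.smul_apply]

instance : SMulCommClass (SmoothFun d M) ℝ X.Γ :=
  ⟨fun f r s => by ext x; simp [VBundle.smul_apply, smul_comm (f x) r (s x)]⟩

/-- The fibrewise contraction of a section of `X*` with a section of `X`. -/
def pairing (α : X.dual.Γ) (s : X.Γ) (x : M) : ℝ :=
  (show X.V x →L[ℝ] ℝ from α x) (s x)

theorem pairing_contMDiff (α : X.dual.Γ) (s : X.Γ) :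
    ContMDiff (𝓡 d) 𝓘(ℝ, ℝ) ∞ (pairing α s) := by
  have := ContMDiff.clm_bundle_apply (F₁ := X.F) (F₂ := ℝ) (E₁ := X.V)
    (E₂ := Bundle.Trivial M ℝ) (ϕ := fun x => α x) α.contMDiff s.contMDiff
  intro x
  have h := this x
  simp only [contMDiffAt_totalSpace] at h
  exact h.2

/-- The support of a section. -/
def VBundle.supp (s : X.Γ) : Set M := closure {x | s x ≠ 0}

/-- The space `Γ₀(X)` of smooth sections with compact support. -/
def VBundle.compactSections (X : VBundle.{u, v, w} d M) : Submodule ℝ X.Γ where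
  carrier := {s | IsCompact (VBundle.supp s)}
  zero_mem' := by simp [VBundle.supp]
  add_mem' := by
    intro a b ha hb
    refine (IsCompact.union ha hb).of_isClosed_subset isClosed_closure ?_
    rw [VBundle.supp, VBundle.supp, VBundle.supp, ← closure_union]
    refine closure_mono fun x hx => ?_
    by_contra h
    simp only [mem_union, mem_ofPred_eq, not_or, not_not] at h
    exact hx (by simp [h.1, h.2])
  smul_mem' := by
    intro c a ha
    refine IsCompact.of_isClosed_subset ha isClosed_closure (closure_mono fun x hx => ?_)
    intro h
    exact hx (by simp [h])

notation "Γ₀" => VBundle.compactSections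

end Bundles

/-! ### Linear differential operators -/

section DifferentialOperators

/-- The commutator `[D, a]` of a linear map with the multiplication by `a`. -/
def mulCommutator {A P Q : Type*} [CommRing A] [Algebra ℝ A] [AddCommGroup P] [Module ℝ P]
    [Module A P] [SMulCommClass A ℝ P] [AddCommGroup Q] [Module ℝ Q] [Module A Q]
    [SMulCommClass A ℝ Q] (D : P →ₗ[ℝ] Q) (a : A) : P →ₗ[ℝ] Q :=
  D ∘ₗ DistribSMul.toLinearMap ℝ P a - DistribSMul.toLinearMap ℝ Q a ∘ₗ D

/-- Linear differential operators of order at most `k` between modules over `A`, in the sense of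
Grothendieck: all `(k+1)`-fold commutators with multiplications vanish. For `A = C^∞(M)` and
modules of sections of vector bundles these are the usual linear differential operators. -/
def IsDiffOpOfOrder (A : Type*) {P Q : Type*} [CommRing A] [Algebra ℝ A] [AddCommGroup P]
    [Module ℝ P] [Module A P] [SMulCommClass A ℝ P] [AddCommGroup Q] [Module ℝ Q] [Module A Q]
    [SMulCommClass A ℝ Q] : ℕ → (P →ₗ[ℝ] Q) → Prop
  | 0, D => ∀ a : A, mulCommutator D a = 0
  | k + 1, D => ∀ a : A, IsDiffOpOfOrder A k (mulCommutator D a)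

variable {d : ℕ} {M : Type u} [TopologicalSpace M] [ChartedSpace (EuclideanSpace ℝ (Fin d)) M]

/-- A linear differential operator `Γ(X) → Γ(Y)`. -/
structure DiffOp (X Y : VBundle.{u, v, w} d M) where
  toLinearMap : X.Γ →ₗ[ℝ] Y.Γ
  isDiffOp : ∃ k, IsDiffOpOfOrder (SmoothFun d M) k toLinearMap

instance (X Y : VBundle.{u, v, w} d M) : CoeFun (DiffOp X Y) fun _ => X.Γ → Y.Γ :=
  ⟨fun P => P.toLinearMap⟩

variable {X Y : VBundle.{u, v, w} d M}

/-- The identity operator. -/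
def DiffOp.id (X : VBundle.{u, v, w} d M) : DiffOp X X :=
  ⟨LinearMap.id, 0, fun a => by ext s; simp [mulCommutator]⟩

theorem exists_cutoff [T2Space M] [IsManifold (𝓡 d) ∞ M] (s : X.Γ) (x : M)
    (hs : ∀ᶠ y in 𝓝 x, s y = 0) : ∃ g : SmoothFun d M, g x = 1 ∧ g • s = 0 := by
  obtain ⟨f, -, hf⟩ := (SmoothBumpFunction.nhds_basis_tsupport (I := 𝓡 d) x).mem_iff.1 hs
  refine ⟨⟨f, f.contMDiff⟩, f.eq_one, ?_⟩
  ext y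
  change f y • s y = 0
  by_cases hy : y ∈ tsupport f
  · rw [show s y = 0 from hf hy, smul_zero]
  · rw [image_eq_zero_of_notMem_tsupport hy, zero_smul]

theorem IsDiffOpOfOrder.apply_eq_zero [T2Space M] [IsManifold (𝓡 d) ∞ M] (k : ℕ)
    (D : X.Γ →ₗ[ℝ] Y.Γ) (hD : IsDiffOpOfOrder (SmoothFun d M) k D) (s : X.Γ) (x : M)
    (hs : ∀ᶠ y in 𝓝 x, s y = 0) : D s x = 0 := by
  obtain ⟨g, hg1, hg0⟩ := exists_cutoff s x hs
  have key : ∀ D : X.Γ →ₗ[ℝ] Y.Γ, (mulCommutator D g s) x = 0 → D s x = 0 := by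
    intro D h
    have h2 : (D (g • s) - g • D s) x = 0 := h
    rw [hg0, map_zero, zero_sub] at h2
    have h3 : -(g x • D s x) = 0 := h2
    rwa [hg1, one_smul, neg_eq_zero] at h3
  induction k generalizing D with
  | zero => exact key D (by rw [hD g]; rfl)
  | succ k ih => exact key D (ih _ (hD g))

variable [T2Space M] [IsManifold (𝓡 d) ∞ M]

/-- Differential operators do not increase supports. -/
theorem DiffOp.supp_subset (P : DiffOp X Y) (s : X.Γ) :
    VBundle.supp (P s) ⊆ VBundle.supp s := by
  obtain ⟨k, hk⟩ := P.isDiffOp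
  refine closure_minimal (fun x hx => ?_) isClosed_closure
  by_contra h
  refine hx (hk.apply_eq_zero k _ s x ?_)
  filter_upwards [isClosed_closure.isOpen_compl.mem_nhds h] with y hy
  by_contra h'
  exact hy (subset_closure h')

/-- The restriction of a differential operator to compactly supported sections. -/
def DiffOp.onCompact (P : DiffOp X Y) : Γ₀ X →ₗ[ℝ] Γ₀ Y :=
  P.toLinearMap.restrict fun s hs =>
    IsCompact.of_isClosed_subset hs isClosed_closure (P.supp_subset s)

end DifferentialOperators

/-! ### Supports, distributional sections -/

section Distributions

variable {d : ℕ} {M : Type u} [TopologicalSpace M] [ChartedSpace (EuclideanSpace ℝ (Fin d)) M]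

/-- The label `±` distinguishing advanced (`+`) from retarded (`-`) objects. -/
inductive Dir
  | plus
  | minus

/-- The opposite label. -/
def Dir.opp : Dir → Dir
  | .plus => .minus
  | .minus => .plus

/-- The sign `±1`. -/
def Dir.sign : Dir → ℝ
  | .plus => 1
  | .minus => -1

/-- `K` meets each slab `{t' ≤ time ≤ t}` in a compact set. -/
def SpatiallyCompact (time : M → ℝ) (K : Set M) : Prop :=
  ∀ t' t : ℝ, IsCompact (K ∩ {x | t' ≤ time x ∧ time x ≤ t})

/-- Supports of the elements of `Γ_±`: spatially compact and contained in
`M_t⁺ = {time ≥ t}`, respectively `M_t⁻ = {time ≤ t}`, for some `t`. -/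
def CausalSupport (time : M → ℝ) : Dir → Set M → Prop
  | .plus, K => SpatiallyCompact time K ∧ ∃ t, ∀ x ∈ K, t ≤ time x
  | .minus, K => SpatiallyCompact time K ∧ ∃ t, ∀ x ∈ K, time x ≤ t

/-- Linear functionals on the test sections `Γ₀(Y)`. The continuous ones (see
`Distr.IsContinuous`) are the distributional sections of `Y*`; distributional sections of `X`
are the continuous elements of `Distr X.dual`. -/
abbrev Distr (Y : VBundle.{u, v, w} d M) : Type _ := Γ₀ Y →ₗ[ℝ] ℝ

variable {X Y Z : VBundle.{u, v, w} d M}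

/-- `p` is bounded on `K` by `B`, for each scalar differential operator in the list `D`. -/
def BoundedOn (D : List (Y.Γ →ₗ[ℝ] SmoothFun d M)) (K : Set M) (s : Y.Γ) (B : ℝ) : Prop :=
  ∀ P ∈ D, ∀ x ∈ K, |P s x| ≤ B

/-- Continuity of a distributional section: on test sections with support in a given compact `K`
it is bounded by finitely many derivatives. -/
def Distr.IsContinuous (q : Distr Y) : Prop :=
  ∀ K : Set M, IsCompact K → ∃ (C : ℝ) (D : List (Y.Γ →ₗ[ℝ] SmoothFun d M)),
    (∀ P ∈ D, ∃ k, IsDiffOpOfOrder (SmoothFun d M) k P) ∧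
    ∀ (s : Γ₀ Y) (B : ℝ), VBundle.supp (s : Y.Γ) ⊆ K → 0 ≤ B → BoundedOn D K s B →
      |q s| ≤ C * B

/-- The support of a distributional section. -/
def Distr.supp (q : Distr Y) : Set M :=
  {x | ∀ O ∈ 𝓝 x, ∃ s : Γ₀ Y, VBundle.supp (s : Y.Γ) ⊆ O ∧ q s ≠ 0}

/-- `q` is a distributional section with advanced/retarded support. -/
def Distr.IsCausal (time : M → ℝ) (σ : Dir) (q : Distr Y) : Prop :=
  q.IsContinuous ∧ CausalSupport time σ q.supp

/-- A compactly supported distributional section of `Y*`, as a functional on all of `Γ(Y)`. -/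
def IsCompactDistr (a : Y.Γ →ₗ[ℝ] ℝ) : Prop :=
  ∃ (K : Set M) (C : ℝ) (D : List (Y.Γ →ₗ[ℝ] SmoothFun d M)), IsCompact K ∧
    (∀ P ∈ D, ∃ k, IsDiffOpOfOrder (SmoothFun d M) k P) ∧
    ∀ (s : Y.Γ) (B : ℝ), 0 ≤ B → BoundedOn D K s B → |a s| ≤ C * B

/-- Exactness, at the middle term, of a pair of consecutive differential operators
`Γ(X) → Γ(Y) → Γ(Z)` in the category of sections with `σ`-support: exactness of
`Γ_σ(X) → Γ_σ(Y) → Γ_σ(Z)` for smooth sections, and exactness of the transposed sequence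
`Γ_σ(Z*) → Γ_σ(Y*) → Γ_σ(X*)` for distributional sections. -/
def ExactPair [T2Space M] [IsManifold (𝓡 d) ∞ M] (time : M → ℝ) (σ : Dir) (b : DiffOp X Y)
    (a : DiffOp Y Z) : Prop :=
  (∀ y : Y.Γ, CausalSupport time σ (VBundle.supp y) →
    (a y = 0 ↔ ∃ x : X.Γ, CausalSupport time σ (VBundle.supp x) ∧ b x = y)) ∧
  (∀ q : Distr Y, q.IsCausal time σ →
    (q ∘ₗ b.onCompact = 0 ↔ ∃ e : Distr Z, e.IsCausal time σ ∧ e ∘ₗ a.onCompact = q))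

variable [MeasurableSpace M]

/-- The measure of a smooth volume form: in each chart it has a smooth positive density. -/
def IsSmoothVolume (d : ℕ) {M : Type u} [TopologicalSpace M]
    [ChartedSpace (EuclideanSpace ℝ (Fin d)) M] [MeasurableSpace M] (μ : Measure M) : Prop :=
  ∀ x : M, ∃ ρ : EuclideanSpace ℝ (Fin d) → ℝ,
    ContDiffOn ℝ ∞ ρ (chartAt (EuclideanSpace ℝ (Fin d)) x).target ∧
    (∀ y ∈ (chartAt (EuclideanSpace ℝ (Fin d)) x).target, 0 < ρ y) ∧
    (μ.restrict (chartAt (EuclideanSpace ℝ (Fin d)) x).source).map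
        (chartAt (EuclideanSpace ℝ (Fin d)) x) =
      (volume.restrict (chartAt (EuclideanSpace ℝ (Fin d)) x).target).withDensity
        fun y => ENNReal.ofReal (ρ y)

/-- The contraction `α_i s^i`: fibrewise contraction followed by integration over `M`. -/
def contraction (μ : Measure M) (α : X.dual.Γ) (s : X.Γ) : ℝ := ∫ x, pairing α s x ∂μ

/-- `P*` is the formal adjoint of `P : Γ(X) → Γ(Y)`. -/
def IsFormalAdjoint (μ : Measure M) (P : DiffOp X Y) (Pt : DiffOp Y.dual X.dual) : Prop :=
  ∀ α ∈ Γ₀ Y.dual, ∀ s ∈ Γ₀ X, contraction μ α (P s) = contraction μ (Pt α) s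

variable [BorelSpace M]

theorem pairing_integrable (μ : Measure M) [IsLocallyFiniteMeasure μ] (α : Γ₀ X.dual) (s : X.Γ) :
    Integrable (pairing (α : X.dual.Γ) s) μ := by
  refine (pairing_contMDiff _ s).continuous.integrable_of_hasCompactSupport ?_
  refine IsCompact.of_isClosed_subset α.2 isClosed_closure (closure_mono fun x hx h => hx ?_)
  have h' : (α : X.dual.Γ) x = (0 : X.V x →L[ℝ] ℝ) := h
  rw [pairing, h']; rfl

/-- The distributional section defined by a smooth section. -/
def ofSmooth (μ : Measure M) [IsLocallyFiniteMeasure μ] (s : X.Γ) : Distr X.dual where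
  toFun α := contraction μ (α : X.dual.Γ) s
  map_add' α β := by
    rw [contraction, contraction, contraction,
      ← integral_add (pairing_integrable μ α s) (pairing_integrable μ β s)]
    rfl
  map_smul' c α := by
    rw [contraction, contraction, RingHom.id_apply, smul_eq_mul, ← integral_const_mul]
    rfl

end Distributions

/-! ### Field equations, functionals, gauge structure, Lagrange anchors -/

section Theory

variable {d : ℕ} {M : Type u} [TopologicalSpace M] [ChartedSpace (EuclideanSpace ℝ (Fin d)) M]

variable {W D F H : VBundle.{u, v, w} d M}

/-- The field configurations: smooth sections of the bundle `W` with values in `U`. -/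
def Configurations (U : Set (TotalSpace W.F W.V)) : Set W.Γ :=
  {φ | ∀ x, TotalSpace.mk' W.F x (φ x) ∈ U}

/-- `φ` and `ψ` have the same `k`-jet at `x`. -/
def SameJet (k : ℕ) (x : M) (φ ψ : W.Γ) : Prop :=
  ∀ P : W.Γ →ₗ[ℝ] SmoothFun d M, IsDiffOpOfOrder (SmoothFun d M) k P → P φ x = P ψ x

/-- `f[φ](x)` is a smooth function of `x` and of the derivatives of `φ` at `x` up to order `k`: it
depends on the `k`-jet of `φ` at `x` only, and smoothly so along smooth finite-dimensional families
of field configurations. -/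
def IsLocalOfOrder (U : Set (TotalSpace W.F W.V)) (k : ℕ) (f : W.Γ → M → ℝ) : Prop :=
  (∀ φ ∈ Configurations U, ∀ ψ ∈ Configurations U, ∀ x, SameJet k x φ ψ → f φ x = f ψ x) ∧
  ∀ (p : ℕ) (O : Set (EuclideanSpace ℝ (Fin p))) (Φ : EuclideanSpace ℝ (Fin p) → W.Γ),
    IsOpen O → (∀ s ∈ O, Φ s ∈ Configurations U) →
    ContMDiffOn ((𝓡 p).prod (𝓡 d)) ((𝓡 d).prod 𝓘(ℝ, W.F)) ∞
      (fun q : EuclideanSpace ℝ (Fin p) × M => TotalSpace.mk' W.F q.2 (Φ q.1 q.2))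
      (O ×ˢ univ) →
    ContMDiffOn ((𝓡 p).prod (𝓡 d)) 𝓘(ℝ, ℝ) ∞
      (fun q : EuclideanSpace ℝ (Fin p) × M => f (Φ q.1) q.2) (O ×ˢ univ)

variable [MeasurableSpace M]

/-- Local field equations `T_a[φ] = 0` for the sections of `W` with values in the open set `U`.
The tangent bundle of the space of fields has the fibre `Γ(W)`. The dynamics bundle is written as
`E = D*`, so that `E* = D`; every bundle of finite rank is of this form. `J` is the Jacobi operator
`T_{a,i}` and `Jt` is its formal adjoint. -/
structure FieldEquations (μ : Measure M) (W D : VBundle.{u, v, w} d M) where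
  U : Set (TotalSpace W.F W.V)
  isOpen_U : IsOpen U
  T : W.Γ → D.dual.Γ
  isLocal_T : ∃ k, ∀ ξ : D.Γ, IsLocalOfOrder U k fun φ => pairing (T φ) ξ
  J : W.Γ → DiffOp W D.dual
  linearization : ∀ φ ∈ Configurations U, ∀ s ∈ Γ₀ W, ∀ (ξ : D.Γ) (x : M),
    HasDerivAt (fun ε : ℝ => pairing (T (φ + ε • s)) ξ x) (pairing (J φ s) ξ x) 0
  Jt : W.Γ → DiffOp D W.dual
  adjoint : ∀ φ ∈ Configurations U, ∀ s ∈ Γ₀ W, ∀ ξ ∈ Γ₀ D,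
    contraction μ (J φ s) ξ = contraction μ (Jt φ ξ) s

variable {μ : Measure M}

/-- The shell `Σ`: the space of solutions. -/
def FieldEquations.shell (𝒯 : FieldEquations μ W D) : Set W.Γ :=
  {φ | φ ∈ Configurations 𝒯.U ∧ 𝒯.T φ = 0}

/-- Equality on shell of two functionals, `f ≈ g`. -/
def FieldEquations.OnShellEq (𝒯 : FieldEquations μ W D) (f g : W.Γ → ℝ) : Prop :=
  ∀ φ ∈ 𝒯.shell, f φ = g φ

/-- The equations are the Euler-Lagrange equations `S_{,i} = 0` of an action `S = ∫ ℓ`, `ℓ` a local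
density: for compactly supported variations `s` of the field, `δS = ∫ ⟨T, s⟩`. -/
def FieldEquations.IsLagrangian (𝒯 : FieldEquations μ W W) : Prop :=
  ∃ (ℓ : W.Γ → M → ℝ) (k : ℕ), IsLocalOfOrder 𝒯.U k ℓ ∧
    ∀ φ ∈ Configurations 𝒯.U, ∀ s ∈ Γ₀ W,
      HasDerivAt (fun ε : ℝ => ∫ x, (ℓ (φ + ε • s) x - ℓ φ x) ∂μ)
        (contraction μ (𝒯.T φ) s) 0

/-- A differentiable functional `A` of the fields with a compactly supported, possibly
distributional, functional derivative `δA = A_{,i}`. (No higher differentiability is required.) -/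
structure CompactFunctional (𝒯 : FieldEquations μ W D) where
  val : W.Γ → ℝ
  δ : W.Γ → W.Γ →ₗ[ℝ] ℝ
  isCompactDistr : ∀ φ ∈ Configurations 𝒯.U, IsCompactDistr (δ φ)
  hasDerivAt : ∀ φ ∈ Configurations 𝒯.U, ∀ s ∈ Γ₀ W,
    HasDerivAt (fun ε : ℝ => val (φ + ε • s)) (δ φ s) 0

/-- A functional as above whose functional derivative is a smooth section. -/
structure RegularFunctional (𝒯 : FieldEquations μ W D) extends CompactFunctional 𝒯 where
  grad : W.Γ → Γ₀ W.dual
  δ_eq : ∀ φ ∈ Configurations 𝒯.U, ∀ s : W.Γ, δ φ s = contraction μ (grad φ : W.dual.Γ) s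

/-- Generators `R` of gauge symmetries and `L` of gauge identities, with their formal adjoints.
The bundles of gauge symmetries and of gauge identities are `F` and `G = H*`. -/
structure GaugeGenerators (𝒯 : FieldEquations μ W D) (F H : VBundle.{u, v, w} d M) where
  R : W.Γ → DiffOp F W
  Rt : W.Γ → DiffOp W.dual F.dual
  R_adjoint : ∀ φ ∈ Configurations 𝒯.U, IsFormalAdjoint μ (R φ) (Rt φ)
  J_R : ∀ φ ∈ 𝒯.shell, ∀ ε : F.Γ, 𝒯.J φ (R φ ε) = 0
  L : W.Γ → DiffOp D.dual H.dual
  Lt : W.Γ → DiffOp H D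
  L_adjoint : ∀ φ ∈ Configurations 𝒯.U, IsFormalAdjoint μ (Lt φ) (L φ)
  L_T : ∀ φ ∈ Configurations 𝒯.U, L φ (𝒯.T φ) = 0

/-- A gauge invariant functional, `A_{,i} R^i_α ≈ 0`. -/
def GaugeGenerators.IsObservable {𝒯 : FieldEquations μ W D} (𝒢 : GaugeGenerators 𝒯 F H)
    (A : CompactFunctional 𝒯) : Prop :=
  ∀ φ ∈ 𝒯.shell, ∀ ε ∈ Γ₀ F, A.δ φ (𝒢.R φ ε) = 0

/-- A Lagrange anchor `V : Γ(E*) → Γ(T𝓜)` with its formal adjoint: `J ∘ V ≈ V* ∘ J*`. -/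
structure IsLagrangeAnchor (𝒯 : FieldEquations μ W D) (V : W.Γ → DiffOp D W)
    (Vt : W.Γ → DiffOp W.dual D.dual) : Prop where
  adjoint : ∀ φ ∈ Configurations 𝒯.U, IsFormalAdjoint μ (V φ) (Vt φ)
  comm : ∀ φ ∈ 𝒯.shell, ∀ ξ : D.Γ, 𝒯.J φ (V φ ξ) = Vt φ (𝒯.Jt φ ξ)

variable [T2Space M] [IsManifold (𝓡 d) ∞ M]

/-- Acyclicity on shell of the complexes of sections with advanced and with retarded supports
`Γ_±(F) → Γ_±(T𝓜) → Γ_±(E) → Γ_±(G)` and `Γ_±(G*) → Γ_±(E*) → Γ_±(T*𝓜) → Γ_±(F*)` with the maps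
`R, J, L` and `L*, J*, R*`, at the middle terms, for smooth and for distributional sections. -/
def GaugeGenerators.IsAcyclic {𝒯 : FieldEquations μ W D} (𝒢 : GaugeGenerators 𝒯 F H)
    (time : M → ℝ) : Prop :=
  ∀ σ : Dir, ∀ φ ∈ 𝒯.shell,
    ExactPair time σ (𝒢.R φ) (𝒯.J φ) ∧ ExactPair time σ (𝒯.J φ) (𝒢.L φ) ∧
    ExactPair time σ (𝒢.Lt φ) (𝒯.Jt φ) ∧ ExactPair time σ (𝒯.Jt φ) (𝒢.Rt φ)

/-- The advanced/retarded fluctuations `V_A^σ` caused by `A`: (distributional) vector fields with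
`σ`-support such that `V_A^σ T_a ≈ V_a A`. -/
def IsFluctuation (𝒯 : FieldEquations μ W D) (V : W.Γ → DiffOp D W) (time : M → ℝ) (σ : Dir)
    (A : CompactFunctional 𝒯) (q : W.Γ → Distr W.dual) : Prop :=
  ∀ φ ∈ 𝒯.shell, (q φ).IsCausal time σ ∧
    ∀ ξ : Γ₀ D, q φ ((𝒯.Jt φ).onCompact ξ) = A.δ φ (V φ (ξ : D.Γ))

/-- The advanced/retarded repercussions `A_σ` of `A`: (distributional) sections of `E*` with
`σ`-support such that `δA ≈ A_σ^a δT_a`. -/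
def IsRepercussion (𝒯 : FieldEquations μ W D) (time : M → ℝ) (σ : Dir)
    (A : CompactFunctional 𝒯) (ζ : W.Γ → Distr D.dual) : Prop :=
  ∀ φ ∈ 𝒯.shell, (ζ φ).IsCausal time σ ∧
    ∀ s : Γ₀ W, A.δ φ (s : W.Γ) = ζ φ ((𝒯.J φ).onCompact s)

/-- The vector field `ζ^a V_a`. -/
def anchored (Vt : W.Γ → DiffOp W.dual D.dual) (ζ : W.Γ → Distr D.dual) : W.Γ → Distr W.dual :=
  fun φ => ζ φ ∘ₗ (Vt φ).onCompact

/-- The action `q B = q^i B_{,i}` of a distributional vector field on a regular functional. -/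
def distrAct {𝒯 : FieldEquations μ W D} (q : W.Γ → Distr W.dual) (B : RegularFunctional 𝒯) :
    W.Γ → ℝ :=
  fun φ => q φ (B.grad φ)

/-- The action `s A = A_{,i} s^i` of a smooth vector field on an arbitrary functional. -/
def smoothAct {𝒯 : FieldEquations μ W D} (s : W.Γ → W.Γ) (A : CompactFunctional 𝒯) : W.Γ → ℝ :=
  fun φ => A.δ φ (s φ)

/-- The bracket `{A,B}^σ = V_A^σ B - V_B^σ A`, for the fluctuation `q = V_A^σ` of an arbitrary
observable `A` and the smooth fluctuation `s = V_B^σ` of a regular observable `B`. -/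
def bracket {𝒯 : FieldEquations μ W D} (A : CompactFunctional 𝒯) (q : W.Γ → Distr W.dual)
    (B : RegularFunctional 𝒯) (s : W.Γ → W.Γ) : W.Γ → ℝ :=
  distrAct q B - smoothAct s A

/-- The bracket `{B,A}^σ = V_B^σ A - V_A^σ B` of the same two observables in the opposite order. -/
def bracketOpp {𝒯 : FieldEquations μ W D} (A : CompactFunctional 𝒯) (q : W.Γ → Distr W.dual)
    (B : RegularFunctional 𝒯) (s : W.Γ → W.Γ) : W.Γ → ℝ :=
  smoothAct s A - distrAct q B

/-- Advanced/retarded Green functions `G^{±ij}` for the Lagrangian equations `S_{,i} = 0`, as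
operators `α ↦ G^{±ij} α_j`: `G^{±in} S_{,nj} = S_{,jn} G^{±ni} = δ^i_j` on shell; `G^{+ij} = 0` if
`i` is later than `j`, and `G^{-ij} = 0` if `i` is earlier than `j`. -/
def IsGreen (𝒯 : FieldEquations μ W W) (time : M → ℝ)
    (G : Dir → W.Γ → Γ₀ W.dual →ₗ[ℝ] W.Γ) : Prop :=
  ∀ φ ∈ 𝒯.shell, ∀ σ : Dir,
    (∀ s : Γ₀ W, G σ φ ((𝒯.J φ).onCompact s) = s) ∧
    (∀ α : Γ₀ W.dual, 𝒯.J φ (G σ φ α) = α) ∧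
    (∀ α : Γ₀ W.dual, SpatiallyCompact time (VBundle.supp (G σ φ α))) ∧
    ∀ (α : Γ₀ W.dual) (t : ℝ), match σ with
      | .plus => (∀ x ∈ VBundle.supp (α : W.dual.Γ), time x ≤ t) →
          ∀ x ∈ VBundle.supp (G σ φ α), time x ≤ t
      | .minus => (∀ x ∈ VBundle.supp (α : W.dual.Γ), t ≤ time x) →
          ∀ x ∈ VBundle.supp (G σ φ α), t ≤ time x

end Theory

end

/-!
The transpose of `V` turns a repercussion `ζ` of `A` (`ζ ∘ J = δA`) into a fluctuation because of
`J ∘ V ≈ V* ∘ J*`. Repercussions exist, and are unique modulo `L*`, by exactness, since the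
derivative of an observable is compactly supported and annihilated by `R*`.

Reciprocity: a fluctuation `q` of `A` is characterised by `q (J* ξ) = A_{,i} V^i_a ξ^a` for test
sections `ξ`. When `ξ` has support of the opposite direction it meets the support of `q` in a
compact set, so `ξ` may be cut off and the identity persists; for a repercussion `ξ` of `B` it reads
`q B = (V ξ) A`. Two fluctuations of `B` with supports of the same direction differ by a Jacobi
field, which is a gauge variation by exactness, so `V ξ` can be replaced by any fluctuation of `B`.
All bracket identities are linear combinations of this one.

For Lagrangian equations `J` is the second variation of the action, hence formally self-adjoint,
which is the anchor condition for `V = 1`. The Green functions invert `J` with supports of the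
right direction, so `q (J* ξ) = A_{,i} ξ^i` with `ξ = G^σ β` determines the fluctuations.
-/

section Supports

variable {d : ℕ} {M : Type u} [TopologicalSpace M] [ChartedSpace (EuclideanSpace ℝ (Fin d)) M]
  {X : VBundle.{u, v, w} d M}

theorem VBundle.isClosed_supp (s : X.Γ) : IsClosed (VBundle.supp s) := isClosed_closure

theorem VBundle.notMem_supp_iff {s : X.Γ} {x : M} :
    x ∉ VBundle.supp s ↔ ∀ᶠ y in 𝓝 x, s y = 0 := by
  simp only [VBundle.supp, mem_closure_iff_frequently, Filter.not_frequently, mem_ofPred_eq,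
    not_not]

theorem VBundle.eq_zero_of_notMem_supp {s : X.Γ} {x : M} (hx : x ∉ VBundle.supp s) : s x = 0 :=
  (VBundle.notMem_supp_iff.1 hx).self_of_nhds

theorem VBundle.supp_subset_of_isClosed {s : X.Γ} {C : Set M} (hC : IsClosed C)
    (h : ∀ x ∉ C, s x = 0) : VBundle.supp s ⊆ C :=
  closure_minimal (fun x hx => not_imp_comm.1 (h x) hx) hC

theorem VBundle.supp_sub_subset (s t : X.Γ) :
    VBundle.supp (s - t) ⊆ VBundle.supp s ∪ VBundle.supp t := by
  refine VBundle.supp_subset_of_isClosed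
    ((VBundle.isClosed_supp s).union (VBundle.isClosed_supp t)) fun x hx => ?_
  rw [mem_union, not_or] at hx
  simp [VBundle.eq_zero_of_notMem_supp hx.1, VBundle.eq_zero_of_notMem_supp hx.2]

theorem VBundle.supp_smul_subset_right (f : SmoothFun d M) (s : X.Γ) :
    VBundle.supp (f • s) ⊆ VBundle.supp s := by
  refine VBundle.supp_subset_of_isClosed (VBundle.isClosed_supp s) fun x hx => ?_
  rw [VBundle.smul_apply, VBundle.eq_zero_of_notMem_supp hx, smul_zero]

theorem VBundle.supp_smul_subset_left (f : SmoothFun d M) (s : X.Γ) :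
    VBundle.supp (f • s) ⊆ tsupport f := by
  refine VBundle.supp_subset_of_isClosed (isClosed_tsupport f) fun x hx => ?_
  rw [VBundle.smul_apply, image_eq_zero_of_notMem_tsupport hx, zero_smul]

theorem VBundle.smul_mem_compactSections {f : SmoothFun d M} (hf : HasCompactSupport f) (s : X.Γ) :
    f • s ∈ Γ₀ X :=
  IsCompact.of_isClosed_subset hf (VBundle.isClosed_supp _) (VBundle.supp_smul_subset_left f s)

variable [T2Space M] [IsManifold (𝓡 d) ∞ M]

theorem exists_smooth_cutoff {K O : Set M} (hK : IsCompact K) (hO : IsOpen O) (hKO : K ⊆ O) :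
    ∃ χ : SmoothFun d M, HasCompactSupport χ ∧ tsupport χ ⊆ O ∧ ∀ᶠ y in 𝓝ˢ K, χ y = 1 := by
  refine hK.induction_on (p := fun K => ∃ χ : SmoothFun d M,
    HasCompactSupport χ ∧ tsupport χ ⊆ O ∧ ∀ᶠ y in 𝓝ˢ K, χ y = 1) ?empty ?mono ?union ?pointwise
  case empty => exact ⟨0, HasCompactSupport.zero, by simp [tsupport], by simp⟩
  case mono =>
    rintro K K' hKK' ⟨χ, hχ, hχO, hχ1⟩
    exact ⟨χ, hχ, hχO, hχ1.filter_mono (nhdsSet_mono hKK')⟩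
  case union =>
    rintro K K' ⟨χ, hχ, hχO, hχ1⟩ ⟨χ', hχ', hχO', hχ1'⟩
    have hsupp : tsupport (χ + χ' - χ * χ' : SmoothFun d M) ⊆ tsupport χ ∪ tsupport χ' := by
      refine closure_minimal (fun x hx => ?_) ((isClosed_tsupport _).union (isClosed_tsupport _))
      contrapose! hx
      rw [mem_union, not_or] at hx
      simp [image_eq_zero_of_notMem_tsupport hx.1, image_eq_zero_of_notMem_tsupport hx.2]
    refine ⟨χ + χ' - χ * χ',
      (hχ.isCompact.union hχ').of_isClosed_subset (isClosed_tsupport _) hsupp,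
      hsupp.trans (union_subset hχO hχO'), ?_⟩
    rw [nhdsSet_union, Filter.eventually_sup]
    exact ⟨hχ1.mono fun y hy => by simp [hy], hχ1'.mono fun y hy => by simp [hy]⟩
  case pointwise =>
    intro x hx
    obtain ⟨f, -, hfO⟩ :=
      (SmoothBumpFunction.nhds_basis_tsupport (I := 𝓡 d) x).mem_iff.1 (hO.mem_nhds (hKO hx))
    refine ⟨{y | ∀ᶠ z in 𝓝 y, f z = 1},
      mem_nhdsWithin_of_mem_nhds f.eventuallyEq_one.eventually_nhds, ⟨f, f.contMDiff⟩,
      f.hasCompactSupport, hfO, eventually_nhdsSet_iff_forall.2 fun y hy => hy⟩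

theorem VBundle.exists_compactSection_eventuallyEq {s : X.Γ} {C : Set M}
    (hC : IsCompact (C ∩ VBundle.supp s)) : ∃ s' : Γ₀ X, ∀ᶠ y in 𝓝ˢ C, (s' : X.Γ) y = s y := by
  obtain ⟨χ, hχ, -, hχ1⟩ := exists_smooth_cutoff (d := d) hC isOpen_univ (subset_univ _)
  refine ⟨⟨χ • s, VBundle.smul_mem_compactSections hχ s⟩,
    eventually_nhdsSet_iff_forall.2 fun x hx => ?_⟩
  by_cases hxs : x ∈ VBundle.supp s
  · filter_upwards [eventually_nhdsSet_iff_forall.1 hχ1 x ⟨hx, hxs⟩] with y hy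
    simp [VBundle.smul_apply, hy]
  · filter_upwards [VBundle.notMem_supp_iff.1 hxs] with y hy
    simp [VBundle.smul_apply, hy]

end Supports

section DifferentialOperators

variable {A P Q R : Type*} [CommRing A] [Algebra ℝ A] [AddCommGroup P] [Module ℝ P]
  [Module A P] [SMulCommClass A ℝ P] [AddCommGroup Q] [Module ℝ Q] [Module A Q]
  [SMulCommClass A ℝ Q] [AddCommGroup R] [Module ℝ R] [Module A R] [SMulCommClass A ℝ R]

theorem mulCommutator_apply (D : P →ₗ[ℝ] Q) (a : A) (s : P) :
    mulCommutator D a s = D (a • s) - a • D s := rfl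

theorem mulCommutator_add (D D' : P →ₗ[ℝ] Q) (a : A) :
    mulCommutator (D + D') a = mulCommutator D a + mulCommutator D' a := by
  ext s
  simp [mulCommutator, sub_add_sub_comm]

theorem mulCommutator_zero (a : A) : mulCommutator (0 : P →ₗ[ℝ] Q) a = 0 := by
  ext s
  simp [mulCommutator]

theorem mulCommutator_comp (D' : Q →ₗ[ℝ] R) (D : P →ₗ[ℝ] Q) (a : A) :
    mulCommutator (D' ∘ₗ D) a = D' ∘ₗ mulCommutator D a + mulCommutator D' a ∘ₗ D := by
  ext s
  simp [mulCommutator]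

theorem IsDiffOpOfOrder.zero (k : ℕ) : IsDiffOpOfOrder A k (0 : P →ₗ[ℝ] Q) := by
  induction k with
  | zero => exact mulCommutator_zero
  | succ k ih => intro a; rwa [mulCommutator_zero]

theorem IsDiffOpOfOrder.add {k : ℕ} {D D' : P →ₗ[ℝ] Q} (h : IsDiffOpOfOrder A k D)
    (h' : IsDiffOpOfOrder A k D') : IsDiffOpOfOrder A k (D + D') := by
  induction k generalizing D D' with
  | zero => intro a; rw [mulCommutator_add, h a, h' a, add_zero]
  | succ k ih => intro a; rw [mulCommutator_add]; exact ih (h a) (h' a)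

theorem IsDiffOpOfOrder.comp {k l : ℕ} {D' : Q →ₗ[ℝ] R} {D : P →ₗ[ℝ] Q}
    (h' : IsDiffOpOfOrder A k D') (h : IsDiffOpOfOrder A l D) :
    IsDiffOpOfOrder A (k + l) (D' ∘ₗ D) := by
  induction hn : k + l generalizing k l D D' with
  | zero =>
    obtain ⟨rfl, rfl⟩ := Nat.add_eq_zero_iff.1 hn
    intro a
    rw [mulCommutator_comp, h a, h' a, LinearMap.comp_zero, LinearMap.zero_comp, add_zero]
  | succ n ih =>
    intro a
    rw [mulCommutator_comp]
    refine IsDiffOpOfOrder.add ?_ ?_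
    · cases l with
      | zero => rw [h a, LinearMap.comp_zero]; exact IsDiffOpOfOrder.zero n
      | succ l => exact ih h' (h a) (by omega)
    · cases k with
      | zero => rw [h' a, LinearMap.zero_comp]; exact IsDiffOpOfOrder.zero n
      | succ k => exact ih (h' a) h (by omega)

theorem IsDiffOpOfOrder.pow_smul_apply_eq_zero {k : ℕ} {D : P →ₗ[ℝ] Q}
    (hD : IsDiffOpOfOrder A k D) {a : A} {s : P} (hs : a • s = 0) : a ^ (k + 1) • D s = 0 := by
  have hcomm (D : P →ₗ[ℝ] Q) : mulCommutator D a s = -(a • D s) := by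
    rw [mulCommutator_apply, hs, map_zero, zero_sub]
  induction k generalizing D with
  | zero => rw [zero_add, pow_one, ← neg_eq_zero, ← hcomm, hD a, LinearMap.zero_apply]
  | succ k ih =>
    have := ih (hD a)
    rwa [hcomm, smul_neg, neg_eq_zero, ← mul_smul, ← pow_succ] at this

variable {d : ℕ} {M : Type u} [TopologicalSpace M] [ChartedSpace (EuclideanSpace ℝ (Fin d)) M]
  [T2Space M] [IsManifold (𝓡 d) ∞ M] {X Y : VBundle.{u, v, w} d M}

theorem IsDiffOpOfOrder.scalar_apply_eq_zero {k : ℕ} {P : X.Γ →ₗ[ℝ] SmoothFun d M}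
    (hP : IsDiffOpOfOrder (SmoothFun d M) k P) {s : X.Γ} {x : M}
    (hs : ∀ᶠ y in 𝓝 x, s y = 0) : P s x = 0 := by
  obtain ⟨g, hgx, hgs⟩ := exists_cutoff s x hs
  have := DFunLike.congr_fun (hP.pow_smul_apply_eq_zero hgs) x
  simpa [hgx] using this

theorem DiffOp.apply_eq_of_eventuallyEq (P : DiffOp X Y) {s t : X.Γ} {x : M}
    (h : ∀ᶠ y in 𝓝 x, s y = t y) : P s x = P t x := by
  obtain ⟨k, hk⟩ := P.isDiffOp
  have := hk.apply_eq_zero k _ (s - t) x (h.mono fun y hy => by simp [hy])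
  simpa [map_sub, sub_eq_zero] using this

theorem DiffOp.eventually_apply_eq (P : DiffOp X Y) {s t : X.Γ} {K : Set M}
    (h : ∀ᶠ y in 𝓝ˢ K, s y = t y) : ∀ᶠ y in 𝓝ˢ K, P s y = P t y :=
  h.eventually_nhdsSet.mono fun _ => P.apply_eq_of_eventuallyEq

theorem SameJet.of_eventuallyEq (k : ℕ) {φ ψ : X.Γ} {x : M} (h : ∀ᶠ y in 𝓝 x, φ y = ψ y) :
    SameJet k x φ ψ := by
  intro P hP
  have := hP.scalar_apply_eq_zero (s := φ - ψ) (h.mono fun y hy => by simp [hy])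
  simpa [map_sub, sub_eq_zero] using this

end DifferentialOperators

section Causality

variable {M : Type u} [TopologicalSpace M] {time : M → ℝ} {σ : Dir} {K C : Set M}

theorem SpatiallyCompact.mono (hK : SpatiallyCompact time K) (hC : IsClosed C) (h : C ⊆ K) :
    SpatiallyCompact time C := fun t' t => by
  rw [← inter_eq_right.2 h, inter_assoc, inter_comm C, ← inter_assoc]
  exact (hK t' t).inter_right hC

theorem SpatiallyCompact.union (hK : SpatiallyCompact time K) (hC : SpatiallyCompact time C) :
    SpatiallyCompact time (K ∪ C) := fun t' t => by
  rw [union_inter_distrib_right]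
  exact (hK t' t).union (hC t' t)

theorem spatiallyCompact_of_isCompact (htime : Continuous time) (hK : IsCompact K) :
    SpatiallyCompact time K := fun _ _ =>
  hK.inter_right ((isClosed_le continuous_const htime).inter (isClosed_le htime continuous_const))

theorem Dir.opp_opp (σ : Dir) : σ.opp.opp = σ := by cases σ <;> rfl

theorem Dir.sign_smul_sub {G : Type*} [AddCommGroup G] [Module ℝ G] (σ : Dir) (f : Dir → G) :
    σ.sign • (f .plus - f .minus) = f σ - f σ.opp := by
  cases σ <;> simp [Dir.opp, Dir.sign]

theorem causalSupport_iff : CausalSupport time σ K ↔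
    SpatiallyCompact time K ∧ ∃ t, ∀ x ∈ K, t ≤ σ.sign * time x := by
  cases σ with
  | plus => simp [CausalSupport, Dir.sign]
  | minus =>
    refine and_congr_right fun _ => (Equiv.neg ℝ).exists_congr fun t => forall₂_congr fun x _ => ?_
    simp [Dir.sign]

theorem CausalSupport.mono (hK : CausalSupport time σ K) (hC : IsClosed C) (h : C ⊆ K) :
    CausalSupport time σ C := by
  obtain ⟨hK, t, ht⟩ := causalSupport_iff.1 hK
  exact causalSupport_iff.2 ⟨hK.mono hC h, t, fun x hx => ht x (h hx)⟩

theorem CausalSupport.union (hK : CausalSupport time σ K) (hC : CausalSupport time σ C) :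
    CausalSupport time σ (K ∪ C) := by
  obtain ⟨hK, t, ht⟩ := causalSupport_iff.1 hK
  obtain ⟨hC, t', ht'⟩ := causalSupport_iff.1 hC
  refine causalSupport_iff.2 ⟨hK.union hC, min t t', ?_⟩
  rintro x (hx | hx)
  exacts [min_le_of_left_le (ht x hx), min_le_of_right_le (ht' x hx)]

theorem causalSupport_of_isCompact (htime : Continuous time) (hK : IsCompact K) (σ : Dir) :
    CausalSupport time σ K := by
  obtain ⟨t, ht⟩ := (hK.image (htime.const_mul σ.sign)).bddBelow
  exact causalSupport_iff.2
    ⟨spatiallyCompact_of_isCompact htime hK, t, fun x hx => ht (mem_image_of_mem _ hx)⟩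

theorem CausalSupport.isCompact_inter (hK : CausalSupport time σ K)
    (hC : CausalSupport time σ.opp C) (hC' : IsClosed C) : IsCompact (K ∩ C) := by
  obtain ⟨hK, t, ht⟩ := causalSupport_iff.1 hK
  obtain ⟨-, t', ht'⟩ := causalSupport_iff.1 hC
  obtain ⟨a, b, hab⟩ : ∃ a b, ∀ x ∈ K ∩ C, a ≤ time x ∧ time x ≤ b := by
    cases σ with
    | plus =>
      refine ⟨t, -t', fun x hx => ⟨?_, ?_⟩⟩ <;>
        linarith [show t ≤ 1 * time x from ht x hx.1, show t' ≤ -1 * time x from ht' x hx.2]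
    | minus =>
      refine ⟨t', -t, fun x hx => ⟨?_, ?_⟩⟩ <;>
        linarith [show t ≤ -1 * time x from ht x hx.1, show t' ≤ 1 * time x from ht' x hx.2]
  rw [← inter_eq_left.2 (show K ∩ C ⊆ {x | a ≤ time x ∧ time x ≤ b} from hab), inter_right_comm]
  exact (hK a b).inter_right hC'

end Causality

section Distributions

variable {d : ℕ} {M : Type u} [TopologicalSpace M] [ChartedSpace (EuclideanSpace ℝ (Fin d)) M]
  {X Y Z : VBundle.{u, v, w} d M} {time : M → ℝ} {σ : Dir} {q q' : Distr Y}

/-- `q` vanishes on the set `O`, i.e. on all test sections supported in `O`. The complement of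
`q.supp` is the largest open set on which `q` vanishes. -/
def Distr.VanishesOn (q : Distr Y) (O : Set M) : Prop :=
  ∀ s : Γ₀ Y, VBundle.supp (s : Y.Γ) ⊆ O → q s = 0

theorem Distr.VanishesOn.mono {O O' : Set M} (h : q.VanishesOn O') (hO : O ⊆ O') :
    q.VanishesOn O :=
  fun s hs => h s (hs.trans hO)

theorem Distr.vanishesOn_empty (q : Distr Y) : q.VanishesOn ∅ := by
  intro s hs
  have : s = 0 := by
    ext x
    exact VBundle.eq_zero_of_notMem_supp fun hx => hs hx
  rw [this, map_zero]

theorem Distr.VanishesOn.sub {O : Set M} (h : q.VanishesOn O) (h' : q'.VanishesOn O) :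
    (q - q').VanishesOn O := fun s hs => by
  rw [LinearMap.sub_apply, h s hs, h' s hs, sub_zero]

theorem Distr.notMem_supp_iff {x : M} : x ∉ q.supp ↔ ∃ O ∈ 𝓝 x, q.VanishesOn O := by
  simp only [Distr.supp, Distr.VanishesOn, mem_ofPred_eq]
  push Not
  rfl

theorem Distr.isClosed_supp (q : Distr Y) : IsClosed q.supp := by
  refine isOpen_compl_iff.1 (isOpen_iff_mem_nhds.2 fun x hx => ?_)
  obtain ⟨O, hO, hq⟩ := Distr.notMem_supp_iff.1 hx
  filter_upwards [eventually_mem_nhds_iff.2 hO] with y hy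
  exact Distr.notMem_supp_iff.2 ⟨O, hy, hq⟩

theorem Distr.supp_sub_subset (q q' : Distr Y) : (q - q').supp ⊆ q.supp ∪ q'.supp := by
  intro x
  contrapose!
  rw [mem_union, not_or]
  rintro ⟨hx, hx'⟩
  obtain ⟨O, hO, hq⟩ := Distr.notMem_supp_iff.1 hx
  obtain ⟨O', hO', hq'⟩ := Distr.notMem_supp_iff.1 hx'
  exact Distr.notMem_supp_iff.2
    ⟨O ∩ O', Filter.inter_mem hO hO', (hq.mono inter_subset_left).sub (hq'.mono inter_subset_right)⟩

theorem BoundedOn.mono {D D' : List (Y.Γ →ₗ[ℝ] SmoothFun d M)} {K : Set M} {s : Y.Γ} {B : ℝ}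
    (h : BoundedOn D' K s B) (hD : D ⊆ D') : BoundedOn D K s B :=
  fun P hP => h P (hD hP)

theorem Distr.IsContinuous.sub (h : q.IsContinuous) (h' : q'.IsContinuous) :
    (q - q').IsContinuous := by
  intro K hK
  obtain ⟨C, D, hD, hq⟩ := h K hK
  obtain ⟨C', D', hD', hq'⟩ := h' K hK
  refine ⟨C + C', D ++ D', fun P hP => (List.mem_append.1 hP).elim (hD P) (hD' P),
    fun s B hs hB hb => ?_⟩
  calc |(q - q') s| ≤ |q s| + |q' s| := abs_sub _ _
    _ ≤ C * B + C' * B := add_le_add (hq s B hs hB (hb.mono (List.subset_append_left _ _)))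
        (hq' s B hs hB (hb.mono (List.subset_append_right _ _)))
    _ = (C + C') * B := by ring

theorem Distr.IsCausal.sub (h : q.IsCausal time σ) (h' : q'.IsCausal time σ) :
    (q - q').IsCausal time σ :=
  ⟨h.1.sub h'.1, (h.2.union h'.2).mono (Distr.isClosed_supp _) (Distr.supp_sub_subset _ _)⟩

variable [T2Space M] [IsManifold (𝓡 d) ∞ M]

theorem Distr.supp_comp_subset (q : Distr Y) (P : DiffOp X Y) :
    Distr.supp (q ∘ₗ P.onCompact) ⊆ q.supp := fun _ hx O hO =>
  let ⟨s, hs, hne⟩ := hx O hO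
  ⟨P.onCompact s, (P.supp_subset _).trans hs, hne⟩

theorem Distr.IsContinuous.comp (h : q.IsContinuous) (P : DiffOp X Y) :
    Distr.IsContinuous (q ∘ₗ P.onCompact) := by
  intro K hK
  obtain ⟨C, D, hD, hq⟩ := h K hK
  obtain ⟨l, hl⟩ := P.isDiffOp
  refine ⟨C, D.map (· ∘ₗ P.toLinearMap), ?_, fun s B hs hB hb => ?_⟩
  · simp only [List.forall_mem_map]
    intro Q hQ
    obtain ⟨k, hk⟩ := hD Q hQ
    exact ⟨k + l, hk.comp hl⟩
  · exact hq (P.onCompact s) B ((P.supp_subset _).trans hs) hB fun Q hQ =>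
      hb _ (List.mem_map_of_mem hQ)

theorem Distr.IsCausal.comp (h : q.IsCausal time σ) (P : DiffOp X Y) :
    Distr.IsCausal time σ (q ∘ₗ P.onCompact) :=
  ⟨h.1.comp P, h.2.mono (Distr.isClosed_supp _) (q.supp_comp_subset P)⟩

theorem Distr.VanishesOn.union {O O' : Set M} (hO : IsOpen O) (hO' : IsOpen O')
    (h : q.VanishesOn O) (h' : q.VanishesOn O') : q.VanishesOn (O ∪ O') := by
  intro s hs
  obtain ⟨χ, hχ, hχO, hχ1⟩ := exists_smooth_cutoff (d := d)
    (IsCompact.diff s.2 hO') hO (sdiff_subset_iff.2 (union_comm O O' ▸ hs))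
  let s₁ : Γ₀ Y := ⟨χ • (s : Y.Γ), VBundle.smul_mem_compactSections hχ _⟩
  have hs₁ : q s₁ = 0 := h s₁ ((VBundle.supp_smul_subset_left _ _).trans hχO)
  have hs₂ : q (s - s₁) = 0 := by
    refine h' _ fun x hx => ?_
    by_contra hxO
    have hxs : x ∈ VBundle.supp (s : Y.Γ) :=
      (VBundle.supp_sub_subset _ _ hx).elim id fun h => VBundle.supp_smul_subset_right _ _ h
    refine VBundle.notMem_supp_iff.2 ?_ hx
    filter_upwards [eventually_nhdsSet_iff_forall.1 hχ1 x ⟨hxs, hxO⟩] with y hy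
    simp [s₁, VBundle.smul_apply, hy]
  rwa [map_sub, hs₁, sub_zero] at hs₂

theorem Distr.vanishesOn_compl_supp (q : Distr Y) : q.VanishesOn q.suppᶜ := by
  intro s hs
  obtain ⟨O, -, hsO, hq⟩ : ∃ O, IsOpen O ∧ VBundle.supp (s : Y.Γ) ⊆ O ∧ q.VanishesOn O := by
    refine IsCompact.induction_on (p := fun K => ∃ O, IsOpen O ∧ K ⊆ O ∧ q.VanishesOn O) s.2
      ⟨∅, isOpen_empty, subset_rfl, q.vanishesOn_empty⟩ ?mono ?union fun x hx => ?pointwise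
    case mono => exact fun K K' hKK' ⟨O, hO, hKO, hq⟩ => ⟨O, hO, hKK'.trans hKO, hq⟩
    case union =>
      exact fun K K' ⟨O, hO, hKO, hq⟩ ⟨O', hO', hKO', hq'⟩ =>
        ⟨O ∪ O', hO.union hO', union_subset_union hKO hKO', hq.union hO hO' hq'⟩
    case pointwise =>
      obtain ⟨O, hO, hq⟩ := Distr.notMem_supp_iff.1 (hs hx)
      exact ⟨interior O, mem_nhdsWithin_of_mem_nhds (interior_mem_nhds.2 hO), interior O,
        isOpen_interior, subset_rfl, hq.mono interior_subset⟩
  exact hq s hsO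

theorem Distr.congr_of_eventuallyEq (q : Distr Y) {s t : Γ₀ Y}
    (h : ∀ᶠ y in 𝓝ˢ q.supp, (s : Y.Γ) y = (t : Y.Γ) y) : q s = q t := by
  rw [← sub_eq_zero, ← map_sub]
  refine q.vanishesOn_compl_supp _ fun x hx hxq => VBundle.notMem_supp_iff.2 ?_ hx
  filter_upwards [eventually_nhdsSet_iff_forall.1 h x hxq] with y hy
  simp [hy]

theorem IsCompactDistr.exists_isCompact {a : Y.Γ →ₗ[ℝ] ℝ} (ha : IsCompactDistr a) :
    ∃ K : Set M, IsCompact K ∧ ∀ s t : Y.Γ, (∀ᶠ y in 𝓝ˢ K, s y = t y) → a s = a t := by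
  obtain ⟨K, C, D, hK, hD, h⟩ := ha
  refine ⟨K, hK, fun s t hst => ?_⟩
  have hbound : |a (s - t)| ≤ C * 0 := by
    refine h _ 0 le_rfl fun P hP x hx => ?_
    obtain ⟨k, hk⟩ := hD P hP
    rw [hk.scalar_apply_eq_zero, abs_zero]
    filter_upwards [eventually_nhdsSet_iff_forall.1 hst x hx] with y hy
    simp [hy]
  rwa [mul_zero, abs_nonpos_iff, map_sub, sub_eq_zero] at hbound

theorem IsCompactDistr.isContinuous {a : Y.Γ →ₗ[ℝ] ℝ} (ha : IsCompactDistr a) :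
    Distr.IsContinuous (a ∘ₗ (Γ₀ Y).subtype) := by
  intro K' _
  obtain ⟨K, C, D, -, hD, h⟩ := ha
  refine ⟨C, D, hD, fun s B hs hB hb => h s B hB fun P hP x _ => ?_⟩
  by_cases hx : x ∈ K'
  · exact hb P hP x hx
  · obtain ⟨k, hk⟩ := hD P hP
    rwa [hk.scalar_apply_eq_zero (VBundle.notMem_supp_iff.1 fun h => hx (hs h)), abs_zero]

theorem IsCompactDistr.isCausal (htime : Continuous time) {a : Y.Γ →ₗ[ℝ] ℝ}
    (ha : IsCompactDistr a) (σ : Dir) : Distr.IsCausal time σ (a ∘ₗ (Γ₀ Y).subtype) := by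
  obtain ⟨K, hK, haK⟩ := ha.exists_isCompact
  refine ⟨ha.isContinuous,
    (causalSupport_of_isCompact htime hK σ).mono (Distr.isClosed_supp _) fun x => ?_⟩
  contrapose!
  refine fun hx => Distr.notMem_supp_iff.2 ⟨Kᶜ, hK.isClosed.isOpen_compl.mem_nhds hx,
    fun s hs => (haK s 0 ?_).trans (map_zero a)⟩
  exact eventually_nhdsSet_iff_forall.2 fun y hy => VBundle.notMem_supp_iff.1 fun h => hs h hy

theorem Distr.apply_eq_of_comp_eq {P : DiffOp X Y} {V : DiffOp X Z} {a : Z.Γ →ₗ[ℝ] ℝ}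
    (ha : IsCompactDistr a) (hq : ∀ ξ : Γ₀ X, q (P.onCompact ξ) = a (V (ξ : X.Γ))) {ξ : X.Γ}
    {β : Γ₀ Y} (hβ : P ξ = β) (hc : IsCompact (q.supp ∩ VBundle.supp ξ)) : q β = a (V ξ) := by
  obtain ⟨K, hK, haK⟩ := ha.exists_isCompact
  have hKc : IsCompact ((K ∪ q.supp) ∩ VBundle.supp ξ) :=
    union_inter_distrib_right K _ _ ▸ (hK.inter_right (VBundle.isClosed_supp ξ)).union hc
  obtain ⟨ξ', hξ'⟩ := VBundle.exists_compactSection_eventuallyEq hKc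
  rw [nhdsSet_union, Filter.eventually_sup] at hξ'
  calc q β = q (P.onCompact ξ') :=
        (q.congr_of_eventuallyEq (hβ ▸ P.eventually_apply_eq hξ'.2)).symm
    _ = a (V (ξ' : X.Γ)) := hq ξ'
    _ = a (V ξ) := haK _ _ (V.eventually_apply_eq hξ'.1)

end Distributions

section Pairing

variable {d : ℕ} {M : Type u} [TopologicalSpace M] [ChartedSpace (EuclideanSpace ℝ (Fin d)) M]
  {X : VBundle.{u, v, w} d M}

theorem pairing_smul_right (f : SmoothFun d M) (α : X.dual.Γ) (s : X.Γ) (x : M) :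
    pairing α (f • s) x = f x * pairing α s x :=
  map_smul (show X.V x →L[ℝ] ℝ from α x) (f x) (s x)

theorem pairing_smul_left (f : SmoothFun d M) (α : X.dual.Γ) (s : X.Γ) (x : M) :
    pairing (f • α) s x = f x * pairing α s x := rfl

theorem pairing_sub_right (α : X.dual.Γ) (s t : X.Γ) (x : M) :
    pairing α (s - t) x = pairing α s x - pairing α t x :=
  map_sub (show X.V x →L[ℝ] ℝ from α x) (s x) (t x)

theorem pairing_sub_left (α β : X.dual.Γ) (s : X.Γ) (x : M) :
    pairing (α - β) s x = pairing α s x - pairing β s x := rfl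

theorem pairing_eq_zero_of_left {α : X.dual.Γ} {x : M} (h : α x = 0) (s : X.Γ) :
    pairing α s x = 0 := by
  have h' : α x = (0 : X.V x →L[ℝ] ℝ) := h
  rw [pairing, h']
  rfl

theorem pairing_eq_zero_of_right {s : X.Γ} {x : M} (h : s x = 0) (α : X.dual.Γ) :
    pairing α s x = 0 := by
  rw [pairing, h, map_zero]

theorem pairing_congr_left {α β : X.dual.Γ} {x : M} (h : α x = β x) (s : X.Γ) :
    pairing α s x = pairing β s x := by
  rw [pairing, pairing, h]

theorem pairing_congr_right {s t : X.Γ} {x : M} (h : s x = t x) (α : X.dual.Γ) :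
    pairing α s x = pairing α t x := by
  rw [pairing, pairing, h]

/-- The contraction `α ↦ ⟨α, s⟩` with a fixed section, as a linear map into `C^∞(M)`; it is the
scalar differential operator bounding the distribution `ofSmooth μ s`. -/
noncomputable def pairingLinear (s : X.Γ) : X.dual.Γ →ₗ[ℝ] SmoothFun d M where
  toFun α := ⟨pairing α s, pairing_contMDiff α s⟩
  map_add' _ _ := rfl
  map_smul' _ _ := rfl

theorem isDiffOpOfOrder_pairingLinear (s : X.Γ) :
    IsDiffOpOfOrder (SmoothFun d M) 0 (pairingLinear s) := by
  intro f
  ext α x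
  exact sub_eq_zero.2 (pairing_smul_left f α s x)

variable [T2Space M] [IsManifold (𝓡 d) ∞ M]

theorem VBundle.exists_section_apply_eq (X : VBundle.{u, v, w} d M) {x : M} (z : X.V x) :
    ∃ s : X.Γ, s x = z := by
  obtain ⟨O, hO, hs⟩ := FiberBundle.exists_contMDiffOn_extend (𝓡 d) X.F (k := ∞) z
  obtain ⟨f, -, hfO⟩ := (SmoothBumpFunction.nhds_basis_tsupport (I := 𝓡 d) x).mem_iff.1
    (interior_mem_nhds.2 hO)
  refine ⟨⟨_, ContMDiffOn.smul_section_of_tsupport f.contMDiff.contMDiffOn isOpen_interior hfO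
    (hs.mono interior_subset)⟩, ?_⟩
  change f x • FiberBundle.extend X.F z x = z
  simp

theorem VBundle.exists_dual_section_ne_zero {s : X.Γ} {x : M} (h : s x ≠ 0) :
    ∃ α : X.dual.Γ, pairing α s x ≠ 0 := by
  let e := (trivializationAt X.F X.V x).continuousLinearEquivAt ℝ x
    (FiberBundle.mem_baseSet_trivializationAt' x)
  obtain ⟨l, hl⟩ := SeparatingDual.exists_ne_zero (R := ℝ) (e.map_eq_zero_iff.not.2 h)
  obtain ⟨α, hα⟩ := VBundle.exists_section_apply_eq X.dual (x := x)
    (show X.V x →L[ℝ] ℝ from l.comp (e : X.V x →L[ℝ] X.F))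
  exact ⟨α, by rwa [pairing, hα]⟩

end Pairing

section Contraction

variable {d : ℕ} {M : Type u} [TopologicalSpace M] [ChartedSpace (EuclideanSpace ℝ (Fin d)) M]
  {X Y : VBundle.{u, v, w} d M} [MeasurableSpace M] {μ : Measure M}

theorem contraction_smul_comm (f : SmoothFun d M) (α : X.dual.Γ) (s : X.Γ) :
    contraction μ (f • α) s = contraction μ α (f • s) := by
  simp only [contraction, pairing_smul_left, pairing_smul_right]

theorem contraction_congr_left {α β : X.dual.Γ} {s : X.Γ}
    (h : ∀ x ∈ VBundle.supp s, α x = β x) : contraction μ α s = contraction μ β s := by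
  refine integral_congr_ae (.of_forall fun x => ?_)
  by_cases hx : x ∈ VBundle.supp s
  · exact pairing_congr_left (h x hx) s
  · simp only [pairing_eq_zero_of_right (VBundle.eq_zero_of_notMem_supp hx)]

theorem contraction_congr_right {α : X.dual.Γ} {s t : X.Γ}
    (h : ∀ x ∈ VBundle.supp α, s x = t x) : contraction μ α s = contraction μ α t := by
  refine integral_congr_ae (.of_forall fun x => ?_)
  by_cases hx : x ∈ VBundle.supp α
  · exact pairing_congr_right (h x hx) α
  · simp only [pairing_eq_zero_of_left (VBundle.eq_zero_of_notMem_supp hx)]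

section Adjoints

variable [T2Space M] [IsManifold (𝓡 d) ∞ M]

theorem contraction_adjoint_of_left {P : DiffOp X Y.dual} {Pt : DiffOp Y X.dual}
    (h : ∀ s ∈ Γ₀ X, ∀ ξ ∈ Γ₀ Y, contraction μ (P s) ξ = contraction μ (Pt ξ) s)
    {s : X.Γ} (hs : s ∈ Γ₀ X) (ξ : Y.Γ) : contraction μ (P s) ξ = contraction μ (Pt ξ) s := by
  obtain ⟨ξ', hξ'⟩ := VBundle.exists_compactSection_eventuallyEq (s := ξ)
    (IsCompact.inter_right hs (VBundle.isClosed_supp ξ))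
  calc contraction μ (P s) ξ = contraction μ (P s) ξ' := (contraction_congr_right fun x hx =>
        hξ'.self_of_nhdsSet x (P.supp_subset s hx)).symm
    _ = contraction μ (Pt ξ') s := h s hs ξ' ξ'.2
    _ = contraction μ (Pt ξ) s :=
        contraction_congr_left (Pt.eventually_apply_eq hξ').self_of_nhdsSet

theorem contraction_adjoint_of_right {P : DiffOp X Y.dual} {Pt : DiffOp Y X.dual}
    (h : ∀ s ∈ Γ₀ X, ∀ ξ ∈ Γ₀ Y, contraction μ (P s) ξ = contraction μ (Pt ξ) s)
    (s : X.Γ) {ξ : Y.Γ} (hξ : ξ ∈ Γ₀ Y) : contraction μ (P s) ξ = contraction μ (Pt ξ) s :=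
  (contraction_adjoint_of_left (fun ξ hξ s hs => (h s hs ξ hξ).symm) hξ s).symm

theorem IsFormalAdjoint.contraction_eq {P : DiffOp X Y} {Pt : DiffOp Y.dual X.dual}
    (h : IsFormalAdjoint μ P Pt) {α : Y.dual.Γ} (hα : α ∈ Γ₀ Y.dual) (s : X.Γ) :
    contraction μ α (P s) = contraction μ (Pt α) s := by
  obtain ⟨s', hs'⟩ := VBundle.exists_compactSection_eventuallyEq (s := s)
    (IsCompact.inter_right hα (VBundle.isClosed_supp s))
  calc contraction μ α (P s) = contraction μ α (P s') :=
        (contraction_congr_right (P.eventually_apply_eq hs').self_of_nhdsSet).symm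
    _ = contraction μ (Pt α) s' := h α hα s' s'.2
    _ = contraction μ (Pt α) s := contraction_congr_right fun x hx =>
        hs'.self_of_nhdsSet x (Pt.supp_subset α hx)

end Adjoints

variable [BorelSpace M]

theorem IsSmoothVolume.isOpenPosMeasure (hμ : IsSmoothVolume d μ) : μ.IsOpenPosMeasure := by
  refine ⟨fun O hO ⟨x, hx⟩ hμO => ?_⟩
  obtain ⟨ρ, hρ, hpos, hmap⟩ := hμ x
  set e := chartAt (EuclideanSpace ℝ (Fin d)) x
  have he : AEMeasurable e (μ.restrict e.source) :=
    e.continuousOn.aemeasurable e.open_source.measurableSet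
  have hρm : AEMeasurable (fun y => ENNReal.ofReal (ρ y)) (volume.restrict e.target) :=
    (hρ.continuousOn.aemeasurable e.open_target.measurableSet).ennreal_ofReal
  have hS : IsOpen (e.target ∩ e.symm ⁻¹' O) := e.isOpen_inter_preimage_symm hO
  have hnull : (μ.restrict e.source).map e (e.target ∩ e.symm ⁻¹' O) = 0 := by
    rw [Measure.map_apply_of_aemeasurable he hS.measurableSet,
      Measure.restrict_apply' e.open_source.measurableSet]
    refine measure_mono_null (fun y hy => ?_) hμO
    simpa only [mem_preimage, e.left_inv hy.2] using hy.1.2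
  rw [hmap, withDensity_apply_eq_zero' hρm, Measure.restrict_apply' e.open_target.measurableSet]
    at hnull
  refine (hS.measure_pos volume ⟨e x, e.map_source (mem_chart_source _ x), ?_⟩).ne'
    (measure_mono_null (fun y hy => ?_) hnull)
  · rwa [mem_preimage, e.left_inv (mem_chart_source _ x)]
  · exact ⟨⟨(ENNReal.ofReal_pos.2 (hpos y hy.1)).ne', hy⟩, hy.1⟩

variable [IsLocallyFiniteMeasure μ]

theorem pairing_integrable_of_right (α : X.dual.Γ) (s : Γ₀ X) :
    Integrable (pairing α (s : X.Γ)) μ := by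
  refine (pairing_contMDiff _ _).continuous.integrable_of_hasCompactSupport ?_
  exact IsCompact.of_isClosed_subset s.2 isClosed_closure
    (closure_mono fun x hx h => hx (pairing_eq_zero_of_right h α))

variable [T2Space M] [IsManifold (𝓡 d) ∞ M] [μ.IsOpenPosMeasure]

theorem pairing_eq_zero_of_forall_contraction {α : X.dual.Γ} {s : X.Γ} {O : Set M} (hO : IsOpen O)
    (h : ∀ f : SmoothFun d M, HasCompactSupport f → tsupport f ⊆ O → contraction μ α (f • s) = 0)
    {x : M} (hx : x ∈ O) : pairing α s x = 0 := by
  obtain ⟨χ, -, hχO⟩ :=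
    (SmoothBumpFunction.nhds_basis_tsupport (I := 𝓡 d) x).mem_iff.1 (hO.mem_nhds hx)
  let g : SmoothFun d M := ⟨pairing α s, pairing_contMDiff α s⟩
  let f : SmoothFun d M := ⟨χ, χ.contMDiff⟩ * g
  have hf : contraction μ α (f • s) = 0 :=
    h f χ.hasCompactSupport.mul_right (tsupport_mul_subset_left.trans hχO)
  by_contra hne
  have hpos : 0 < ∫ y, χ y * (pairing α s y * pairing α s y) ∂μ := by
    refine Continuous.integral_pos_of_hasCompactSupport_nonneg_nonzero (x := x) ?_
      χ.hasCompactSupport.mul_right (fun y => mul_nonneg χ.nonneg (mul_self_nonneg _)) ?_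
    · have := g.contMDiff.continuous
      exact χ.contMDiff.continuous.mul (this.mul this)
    · simp [hne]
  refine hpos.ne' (Eq.trans (integral_congr_ae (.of_forall fun y => ?_)) hf)
  exact ((pairing_smul_right f α s y).trans (mul_assoc _ _ _)).symm

/-- The fundamental lemma of the calculus of variations. -/
theorem dual_ext_of_contraction {α β : X.dual.Γ}
    (h : ∀ s ∈ Γ₀ X, contraction μ α s = contraction μ β s) : α = β := by
  have hαβ (s : Γ₀ X) : contraction μ (α - β) s = 0 := by
    simp only [contraction, pairing_sub_left]
    rw [integral_sub (pairing_integrable_of_right α s) (pairing_integrable_of_right β s)]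
    exact sub_eq_zero.2 (h s s.2)
  ext x : 1
  refine sub_eq_zero.1 (ContinuousLinearMap.ext fun z => ?_)
  obtain ⟨s, rfl⟩ := X.exists_section_apply_eq z
  exact pairing_eq_zero_of_forall_contraction (μ := μ) isOpen_univ
    (fun f hf _ => hαβ ⟨_, VBundle.smul_mem_compactSections hf s⟩) (mem_univ x)

end Contraction

section RegularDistributions

variable {d : ℕ} {M : Type u} [TopologicalSpace M] [ChartedSpace (EuclideanSpace ℝ (Fin d)) M]
  {X : VBundle.{u, v, w} d M} [MeasurableSpace M] [BorelSpace M] {μ : Measure M}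
  [IsLocallyFiniteMeasure μ]

theorem ofSmooth_apply (s : X.Γ) (α : Γ₀ X.dual) :
    ofSmooth μ s α = contraction μ (α : X.dual.Γ) s := rfl

theorem ofSmooth_sub (s t : X.Γ) : ofSmooth μ (s - t) = ofSmooth μ s - ofSmooth μ t := by
  ext α
  simp only [LinearMap.sub_apply, ofSmooth_apply, contraction, pairing_sub_right]
  exact integral_sub (pairing_integrable μ α s) (pairing_integrable μ α t)

theorem ofSmooth_isContinuous (s : X.Γ) : (ofSmooth μ s).IsContinuous := by
  intro K hK
  refine ⟨μ.real K, [pairingLinear s],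
    List.forall_mem_singleton.2 ⟨0, isDiffOpOfOrder_pairingLinear s⟩, fun α B hα _ hb => ?_⟩
  have hz : ∀ x ∉ K, pairing (α : X.dual.Γ) s x = 0 := fun x hx =>
    pairing_eq_zero_of_left (VBundle.eq_zero_of_notMem_supp fun h => hx (hα h)) s
  rw [ofSmooth_apply, contraction, ← setIntegral_eq_integral_of_forall_compl_eq_zero hz,
    ← Real.norm_eq_abs, mul_comm]
  exact norm_setIntegral_le_of_norm_le_const hK.measure_lt_top
    (hb _ (List.mem_singleton_self _))

variable [T2Space M] [IsManifold (𝓡 d) ∞ M] [μ.IsOpenPosMeasure]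

theorem vanishesOn_ofSmooth_iff {s : X.Γ} {O : Set M} (hO : IsOpen O) :
    (ofSmooth μ s).VanishesOn O ↔ ∀ x ∈ O, s x = 0 := by
  refine ⟨fun h x hx => ?_, fun h α hα => integral_eq_zero_of_ae (.of_forall fun x => ?_)⟩
  · by_contra hne
    obtain ⟨α, hα⟩ := VBundle.exists_dual_section_ne_zero hne
    refine hα (pairing_eq_zero_of_forall_contraction (μ := μ) hO (fun f hf hfO => ?_) hx)
    rw [← contraction_smul_comm]
    exact h ⟨_, VBundle.smul_mem_compactSections hf α⟩
      ((VBundle.supp_smul_subset_left f α).trans hfO)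
  · by_cases hx : x ∈ O
    · exact pairing_eq_zero_of_right (h x hx) _
    · exact pairing_eq_zero_of_left (VBundle.eq_zero_of_notMem_supp fun h => hx (hα h)) s

theorem supp_ofSmooth (s : X.Γ) : (ofSmooth μ s).supp = VBundle.supp s := by
  ext x
  rw [← not_iff_not, Distr.notMem_supp_iff]
  constructor
  · rintro ⟨O, hO, hs⟩
    rw [VBundle.notMem_supp_iff]
    filter_upwards [interior_mem_nhds.2 hO] with y hy
    exact (vanishesOn_ofSmooth_iff isOpen_interior).1 (hs.mono interior_subset) y hy
  · have hopen := (VBundle.isClosed_supp s).isOpen_compl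
    exact fun hx => ⟨_, hopen.mem_nhds hx,
      (vanishesOn_ofSmooth_iff hopen).2 fun y hy => VBundle.eq_zero_of_notMem_supp hy⟩

theorem ofSmooth_injective : Function.Injective (ofSmooth μ : X.Γ → Distr X.dual) := by
  intro s t h
  have hst : (ofSmooth μ (s - t)).VanishesOn univ := fun α _ => by
    rw [ofSmooth_sub, h, sub_self, LinearMap.zero_apply]
  ext x
  exact sub_eq_zero.1 ((vanishesOn_ofSmooth_iff isOpen_univ).1 hst x (mem_univ x))

theorem ofSmooth_isCausal_iff {time : M → ℝ} {σ : Dir} {s : X.Γ} :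
    (ofSmooth μ s).IsCausal time σ ↔ CausalSupport time σ (VBundle.supp s) := by
  rw [Distr.IsCausal, supp_ofSmooth, and_iff_right (ofSmooth_isContinuous s)]

end RegularDistributions

section Reciprocity

variable {d : ℕ} {M : Type u} [TopologicalSpace M] [ChartedSpace (EuclideanSpace ℝ (Fin d)) M]
  [MeasurableSpace M] {W D F H : VBundle.{u, v, w} d M} {μ : Measure M} {𝒯 : FieldEquations μ W D}

section OnShell

variable {f f' g g' : W.Γ → ℝ}

theorem FieldEquations.OnShellEq.symm (h : 𝒯.OnShellEq f g) : 𝒯.OnShellEq g f :=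
  fun φ hφ => (h φ hφ).symm

theorem FieldEquations.OnShellEq.trans (h : 𝒯.OnShellEq f g) (h' : 𝒯.OnShellEq g g') :
    𝒯.OnShellEq f g' :=
  fun φ hφ => (h φ hφ).trans (h' φ hφ)

theorem FieldEquations.OnShellEq.sub (h : 𝒯.OnShellEq f g) (h' : 𝒯.OnShellEq f' g') :
    𝒯.OnShellEq (f - f') (g - g') :=
  fun φ hφ => congr_arg₂ (· - ·) (h φ hφ) (h' φ hφ)

theorem bracketOpp_eq_neg_bracket (A : CompactFunctional 𝒯) (q : W.Γ → Distr W.dual)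
    (B : RegularFunctional 𝒯) (s : W.Γ → W.Γ) : bracketOpp A q B s = -bracket A q B s :=
  (neg_sub _ _).symm

end OnShell

variable [T2Space M] [IsManifold (𝓡 d) ∞ M] {𝒢 : GaugeGenerators 𝒯 F H} {time : M → ℝ}
  {V : W.Γ → DiffOp D W} {Vt : W.Γ → DiffOp W.dual D.dual} {σ : Dir} {A : CompactFunctional 𝒯}
  {q q' : W.Γ → Distr W.dual} {s s' : W.Γ → W.Γ} {φ : W.Γ}

theorem GaugeGenerators.IsObservable.apply_eq_zero (hA : 𝒢.IsObservable A) (hφ : φ ∈ 𝒯.shell)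
    (ε : F.Γ) : A.δ φ (𝒢.R φ ε) = 0 := by
  obtain ⟨K, hK, hAK⟩ := (A.isCompactDistr φ hφ.1).exists_isCompact
  obtain ⟨ε', hε'⟩ := VBundle.exists_compactSection_eventuallyEq (s := ε)
    (hK.inter_right (VBundle.isClosed_supp ε))
  rw [← hA φ hφ ε' ε'.2]
  exact (hAK _ _ ((𝒢.R φ).eventually_apply_eq hε')).symm

theorem GaugeGenerators.IsObservable.exists_isRepercussion (hA : 𝒢.IsObservable A)
    (h𝒢 : 𝒢.IsAcyclic time) (htime : Continuous time) (σ : Dir) :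
    ∃ ζ, IsRepercussion 𝒯 time σ A ζ := by
  have h : ∀ φ, ∃ e : Distr D.dual, φ ∈ 𝒯.shell →
      e.IsCausal time σ ∧ ∀ s : Γ₀ W, A.δ φ (s : W.Γ) = e ((𝒯.J φ).onCompact s) := by
    intro φ
    by_cases hφ : φ ∈ 𝒯.shell
    · obtain ⟨e, he, heq⟩ := ((h𝒢 σ φ hφ).1.2 _
        ((A.isCompactDistr φ hφ.1).isCausal htime σ)).1
        (LinearMap.ext fun ε => hA φ hφ ε ε.2)
      exact ⟨e, fun _ => ⟨he, fun s => (LinearMap.congr_fun heq s).symm⟩⟩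
    · exact ⟨0, fun hmem => absurd hmem hφ⟩
  choose ζ hζ using h
  exact ⟨ζ, hζ⟩

theorem IsRepercussion.exists_sub_eq (h𝒢 : 𝒢.IsAcyclic time) {ζ ζ' : W.Γ → Distr D.dual}
    (hζ : IsRepercussion 𝒯 time σ A ζ) (hζ' : IsRepercussion 𝒯 time σ A ζ')
    (hφ : φ ∈ 𝒯.shell) :
    ∃ m : Distr H.dual, m.IsCausal time σ ∧ ζ' φ - ζ φ = m ∘ₗ (𝒢.L φ).onCompact := by
  have hJ : (ζ' φ - ζ φ) ∘ₗ (𝒯.J φ).onCompact = 0 := by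
    ext s
    rw [LinearMap.comp_apply, LinearMap.sub_apply, ← (hζ φ hφ).2, ← (hζ' φ hφ).2, sub_self,
      LinearMap.zero_apply]
  obtain ⟨m, hm, heq⟩ := ((h𝒢 σ φ hφ).2.1.2 _ ((hζ' φ hφ).1.sub (hζ φ hφ).1)).1 hJ
  exact ⟨m, hm, heq.symm⟩

theorem IsRepercussion.isFluctuation_anchored (hV : IsLagrangeAnchor 𝒯 V Vt)
    {ζ : W.Γ → Distr D.dual} (hζ : IsRepercussion 𝒯 time σ A ζ) :
    IsFluctuation 𝒯 V time σ A (anchored Vt ζ) := by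
  refine fun φ hφ => ⟨(hζ φ hφ).1.comp _, fun ξ => ?_⟩
  calc ζ φ ((Vt φ).onCompact ((𝒯.Jt φ).onCompact ξ))
      = ζ φ ((𝒯.J φ).onCompact ((V φ).onCompact ξ)) :=
        congr_arg (ζ φ) (Subtype.ext (hV.comm φ hφ ξ).symm)
    _ = A.δ φ (V φ (ξ : D.Γ)) := ((hζ φ hφ).2 _).symm

theorem IsFluctuation.apply_eq (hq : IsFluctuation 𝒯 V time σ A q) (hφ : φ ∈ 𝒯.shell) {ξ : D.Γ}
    (hξ : CausalSupport time σ.opp (VBundle.supp ξ)) {β : Γ₀ W.dual} (hβ : 𝒯.Jt φ ξ = β) :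
    q φ β = A.δ φ (V φ ξ) :=
  Distr.apply_eq_of_comp_eq (A.isCompactDistr φ hφ.1) (hq φ hφ).2 hβ
    ((hq φ hφ).1.2.isCompact_inter hξ (VBundle.isClosed_supp ξ))

variable [BorelSpace M] [IsLocallyFiniteMeasure μ] [μ.IsOpenPosMeasure] {B : RegularFunctional 𝒯}

theorem isRepercussion_ofSmooth_iff {ξ : W.Γ → D.Γ} :
    IsRepercussion 𝒯 time σ B.toCompactFunctional (fun φ => ofSmooth μ (ξ φ)) ↔
      ∀ φ ∈ 𝒯.shell, CausalSupport time σ (VBundle.supp (ξ φ)) ∧ 𝒯.Jt φ (ξ φ) = B.grad φ := by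
  refine forall₂_congr fun φ hφ => and_congr ofSmooth_isCausal_iff ?_
  have hδ (s : Γ₀ W) : B.δ φ s = contraction μ (B.grad φ : W.dual.Γ) s := B.δ_eq φ hφ.1 s
  have hJ (s : Γ₀ W) : ofSmooth μ (ξ φ) ((𝒯.J φ).onCompact s) = contraction μ (𝒯.Jt φ (ξ φ)) s :=
    contraction_adjoint_of_left (𝒯.adjoint φ hφ.1) s.2 (ξ φ)
  simp only [hδ, hJ]
  exact ⟨fun h => dual_ext_of_contraction (μ := μ) fun s hs => (h ⟨s, hs⟩).symm,
    fun h s => by rw [h]⟩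

theorem isFluctuation_ofSmooth_iff (hV : ∀ φ ∈ 𝒯.shell, IsFormalAdjoint μ (V φ) (Vt φ)) :
    IsFluctuation 𝒯 V time σ B.toCompactFunctional (fun φ => ofSmooth μ (s φ)) ↔
      ∀ φ ∈ 𝒯.shell, CausalSupport time σ (VBundle.supp (s φ)) ∧
        𝒯.J φ (s φ) = Vt φ (B.grad φ : W.dual.Γ) := by
  refine forall₂_congr fun φ hφ => and_congr ofSmooth_isCausal_iff ?_
  have hJ (ξ : Γ₀ D) : ofSmooth μ (s φ) ((𝒯.Jt φ).onCompact ξ) = contraction μ (𝒯.J φ (s φ)) ξ :=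
    (contraction_adjoint_of_right (𝒯.adjoint φ hφ.1) (s φ) ξ.2).symm
  have hδ (ξ : Γ₀ D) :
      B.δ φ (V φ (ξ : D.Γ)) = contraction μ (Vt φ (B.grad φ : W.dual.Γ)) (ξ : D.Γ) := by
    rw [B.δ_eq φ hφ.1, (hV φ hφ).contraction_eq (B.grad φ).2]
  simp only [hδ, hJ]
  exact ⟨fun h => dual_ext_of_contraction (μ := μ) fun ξ hξ => h ⟨ξ, hξ⟩, fun h ξ => by rw [h]⟩

theorem GaugeGenerators.IsObservable.exists_Jt_eq_grad
    (hB : 𝒢.IsObservable B.toCompactFunctional) (h𝒢 : 𝒢.IsAcyclic time) (htime : Continuous time)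
    (σ : Dir) (hφ : φ ∈ 𝒯.shell) :
    ∃ ξ : D.Γ, CausalSupport time σ (VBundle.supp ξ) ∧ 𝒯.Jt φ ξ = B.grad φ := by
  have hRt : 𝒢.Rt φ (B.grad φ : W.dual.Γ) = 0 := by
    refine dual_ext_of_contraction (μ := μ) fun ε hε => ?_
    rw [← 𝒢.R_adjoint φ hφ.1 _ (B.grad φ).2 ε hε, ← B.δ_eq φ hφ.1, hB φ hφ ε hε]
    exact integral_zero M ℝ |>.symm
  exact ((h𝒢 σ φ hφ).2.2.2.1 _ (causalSupport_of_isCompact htime (B.grad φ).2 σ)).1 hRt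

theorem GaugeGenerators.IsObservable.exists_smooth_isRepercussion
    (hB : 𝒢.IsObservable B.toCompactFunctional) (h𝒢 : 𝒢.IsAcyclic time) (htime : Continuous time)
    (σ : Dir) : ∃ ξ : W.Γ → D.Γ,
      IsRepercussion 𝒯 time σ B.toCompactFunctional fun φ => ofSmooth μ (ξ φ) := by
  have h : ∀ φ, ∃ ξ : D.Γ, φ ∈ 𝒯.shell →
      CausalSupport time σ (VBundle.supp ξ) ∧ 𝒯.Jt φ ξ = B.grad φ := by
    intro φ
    by_cases hφ : φ ∈ 𝒯.shell
    · obtain ⟨ξ, hξ⟩ := hB.exists_Jt_eq_grad h𝒢 htime σ hφ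
      exact ⟨ξ, fun _ => hξ⟩
    · exact ⟨0, fun hmem => absurd hmem hφ⟩
  choose ξ hξ using h
  exact ⟨ξ, isRepercussion_ofSmooth_iff.2 hξ⟩

theorem IsRepercussion.exists_smooth_sub_eq (h𝒢 : 𝒢.IsAcyclic time) {ξ ξ' : W.Γ → D.Γ}
    (hξ : IsRepercussion 𝒯 time σ B.toCompactFunctional fun φ => ofSmooth μ (ξ φ))
    (hξ' : IsRepercussion 𝒯 time σ B.toCompactFunctional fun φ => ofSmooth μ (ξ' φ))
    (hφ : φ ∈ 𝒯.shell) :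
    ∃ m : H.Γ, CausalSupport time σ (VBundle.supp m) ∧ ξ' φ - ξ φ = 𝒢.Lt φ m := by
  obtain ⟨hc, hJt⟩ := isRepercussion_ofSmooth_iff.1 hξ φ hφ
  obtain ⟨hc', hJt'⟩ := isRepercussion_ofSmooth_iff.1 hξ' φ hφ
  obtain ⟨m, hm, heq⟩ := ((h𝒢 σ φ hφ).2.2.1.1 (ξ' φ - ξ φ) ((hc'.union hc).mono
    (VBundle.isClosed_supp _) (VBundle.supp_sub_subset _ _))).1
    (by rw [map_sub, hJt, hJt', sub_self])
  exact ⟨m, hm, heq.symm⟩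

theorem IsRepercussion.isFluctuation_ofSmooth (hV : IsLagrangeAnchor 𝒯 V Vt) {ξ : W.Γ → D.Γ}
    (hξ : IsRepercussion 𝒯 time σ B.toCompactFunctional fun φ => ofSmooth μ (ξ φ)) :
    IsFluctuation 𝒯 V time σ B.toCompactFunctional fun φ => ofSmooth μ (V φ (ξ φ)) := by
  refine (isFluctuation_ofSmooth_iff fun φ hφ => hV.adjoint φ hφ.1).2 fun φ hφ => ?_
  obtain ⟨hc, hJt⟩ := isRepercussion_ofSmooth_iff.1 hξ φ hφ
  exact ⟨hc.mono (VBundle.isClosed_supp _) ((V φ).supp_subset _), by rw [hV.comm φ hφ, hJt]⟩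

/-- The difference of two fluctuations is a Jacobi field, hence a gauge variation by acyclicity. -/
theorem IsFluctuation.smoothAct_congr (hV : IsLagrangeAnchor 𝒯 V Vt) (h𝒢 : 𝒢.IsAcyclic time)
    (hA : 𝒢.IsObservable A)
    (hs : IsFluctuation 𝒯 V time σ B.toCompactFunctional fun φ => ofSmooth μ (s φ))
    (hs' : IsFluctuation 𝒯 V time σ B.toCompactFunctional fun φ => ofSmooth μ (s' φ)) :
    𝒯.OnShellEq (smoothAct s A) (smoothAct s' A) := by
  intro φ hφ
  have hadj : ∀ φ ∈ 𝒯.shell, IsFormalAdjoint μ (V φ) (Vt φ) := fun φ hφ => hV.adjoint φ hφ.1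
  obtain ⟨hc, hJ⟩ := (isFluctuation_ofSmooth_iff hadj).1 hs φ hφ
  obtain ⟨hc', hJ'⟩ := (isFluctuation_ofSmooth_iff hadj).1 hs' φ hφ
  obtain ⟨ε, -, hε⟩ := ((h𝒢 σ φ hφ).1.1 (s φ - s' φ) ((hc.union hc').mono
    (VBundle.isClosed_supp _) (VBundle.supp_sub_subset _ _))).1 (by rw [map_sub, hJ, hJ', sub_self])
  rw [← sub_eq_zero, smoothAct, smoothAct, ← map_sub, ← hε, hA.apply_eq_zero hφ]

theorem IsFluctuation.distrAct_eq_smoothAct {ξ : W.Γ → D.Γ} (hq : IsFluctuation 𝒯 V time σ A q)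
    (hξ : IsRepercussion 𝒯 time σ.opp B.toCompactFunctional fun φ => ofSmooth μ (ξ φ)) :
    𝒯.OnShellEq (distrAct q B) (smoothAct (fun φ => V φ (ξ φ)) A) := fun φ hφ =>
  let ⟨hc, hJt⟩ := isRepercussion_ofSmooth_iff.1 hξ φ hφ
  hq.apply_eq hφ hc hJt

theorem IsFluctuation.distrAct_congr (h𝒢 : 𝒢.IsAcyclic time) (htime : Continuous time)
    (hB : 𝒢.IsObservable B.toCompactFunctional) (hq : IsFluctuation 𝒯 V time σ A q)
    (hq' : IsFluctuation 𝒯 V time σ A q') : 𝒯.OnShellEq (distrAct q B) (distrAct q' B) := by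
  obtain ⟨ξ, hξ⟩ := hB.exists_smooth_isRepercussion h𝒢 htime σ.opp
  exact (hq.distrAct_eq_smoothAct hξ).trans (hq'.distrAct_eq_smoothAct hξ).symm

theorem IsFluctuation.reciprocity (hV : IsLagrangeAnchor 𝒯 V Vt) (h𝒢 : 𝒢.IsAcyclic time)
    (htime : Continuous time) (hA : 𝒢.IsObservable A)
    (hB : 𝒢.IsObservable B.toCompactFunctional) (hq : IsFluctuation 𝒯 V time σ A q)
    (hs : IsFluctuation 𝒯 V time σ.opp B.toCompactFunctional fun φ => ofSmooth μ (s φ)) :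
    𝒯.OnShellEq (distrAct q B) (smoothAct s A) := by
  obtain ⟨ξ, hξ⟩ := hB.exists_smooth_isRepercussion h𝒢 htime σ.opp
  exact (hq.distrAct_eq_smoothAct hξ).trans
    ((hξ.isFluctuation_ofSmooth hV).smoothAct_congr hV h𝒢 hA hs)

theorem bracket_eq_bracketOpp (hV : IsLagrangeAnchor 𝒯 V Vt) (h𝒢 : 𝒢.IsAcyclic time)
    (htime : Continuous time) (hA : 𝒢.IsObservable A)
    (hB : 𝒢.IsObservable B.toCompactFunctional) {qA : Dir → W.Γ → Distr W.dual}
    {sB : Dir → W.Γ → W.Γ} (hq : ∀ σ, IsFluctuation 𝒯 V time σ A (qA σ))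
    (hs : ∀ σ, IsFluctuation 𝒯 V time σ B.toCompactFunctional fun φ => ofSmooth μ (sB σ φ))
    (σ : Dir) :
    𝒯.OnShellEq (bracket A (qA σ) B (sB σ)) (bracketOpp A (qA σ.opp) B (sB σ.opp)) :=
  ((hq σ).reciprocity hV h𝒢 htime hA hB (hs σ.opp)).sub
    ((hq σ.opp).reciprocity hV h𝒢 htime hA hB (σ.opp_opp.symm ▸ hs σ)).symm

theorem bracket_eq_distrAct_sub (hV : IsLagrangeAnchor 𝒯 V Vt) (h𝒢 : 𝒢.IsAcyclic time)
    (htime : Continuous time) (hA : 𝒢.IsObservable A)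
    (hB : 𝒢.IsObservable B.toCompactFunctional) (hq : IsFluctuation 𝒯 V time σ A q)
    (hs : IsFluctuation 𝒯 V time σ B.toCompactFunctional fun φ => ofSmooth μ (s φ))
    {q' : Dir → W.Γ → Distr W.dual} (hq' : ∀ σ, IsFluctuation 𝒯 V time σ A (q' σ)) :
    𝒯.OnShellEq (bracket A q B s) (σ.sign • (distrAct (q' .plus) B - distrAct (q' .minus) B)) := by
  rw [Dir.sign_smul_sub σ fun τ => distrAct (q' τ) B]
  exact (hq.distrAct_congr h𝒢 htime hB (hq' σ)).sub
    ((hq' σ.opp).reciprocity hV h𝒢 htime hA hB (σ.opp_opp.symm ▸ hs)).symm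

theorem bracketOpp_eq_smoothAct_sub (hV : IsLagrangeAnchor 𝒯 V Vt) (h𝒢 : 𝒢.IsAcyclic time)
    (htime : Continuous time) (hA : 𝒢.IsObservable A)
    (hB : 𝒢.IsObservable B.toCompactFunctional) (hq : IsFluctuation 𝒯 V time σ A q)
    (hs : IsFluctuation 𝒯 V time σ B.toCompactFunctional fun φ => ofSmooth μ (s φ))
    {s' : Dir → W.Γ → W.Γ}
    (hs' : ∀ σ, IsFluctuation 𝒯 V time σ B.toCompactFunctional fun φ => ofSmooth μ (s' σ φ)) :
    𝒯.OnShellEq (bracketOpp A q B s)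
      (σ.sign • (smoothAct (s' .plus) A - smoothAct (s' .minus) A)) := by
  rw [Dir.sign_smul_sub σ fun τ => smoothAct (s' τ) A]
  exact (hs.smoothAct_congr hV h𝒢 hA (hs' σ)).sub
    (hq.reciprocity hV h𝒢 htime hA hB (hs' σ.opp))

theorem IsRepercussion.bracket_eq (hV : IsLagrangeAnchor 𝒯 V Vt) (h𝒢 : 𝒢.IsAcyclic time)
    (htime : Continuous time) (hA : 𝒢.IsObservable A)
    (hB : 𝒢.IsObservable B.toCompactFunctional) (hq : IsFluctuation 𝒯 V time σ A q)
    (hs : IsFluctuation 𝒯 V time σ B.toCompactFunctional fun φ => ofSmooth μ (s φ))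
    {ζ : Dir → W.Γ → Distr D.dual} (hζ : ∀ σ, IsRepercussion 𝒯 time σ A (ζ σ)) :
    𝒯.OnShellEq (bracket A q B s) (σ.sign • distrAct (anchored Vt (ζ .plus - ζ .minus)) B) :=
  bracket_eq_distrAct_sub hV h𝒢 htime hA hB hq hs fun σ => (hζ σ).isFluctuation_anchored hV

theorem IsRepercussion.bracketOpp_eq (hV : IsLagrangeAnchor 𝒯 V Vt) (h𝒢 : 𝒢.IsAcyclic time)
    (htime : Continuous time) (hA : 𝒢.IsObservable A)
    (hB : 𝒢.IsObservable B.toCompactFunctional) (hq : IsFluctuation 𝒯 V time σ A q)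
    (hs : IsFluctuation 𝒯 V time σ B.toCompactFunctional fun φ => ofSmooth μ (s φ))
    {ξ : Dir → W.Γ → D.Γ}
    (hξ : ∀ σ, IsRepercussion 𝒯 time σ B.toCompactFunctional fun φ => ofSmooth μ (ξ σ φ)) :
    𝒯.OnShellEq (bracketOpp A q B s)
      (σ.sign • smoothAct (fun φ => V φ (ξ .plus φ - ξ .minus φ)) A) := by
  have hsub : smoothAct (fun φ => V φ (ξ .plus φ - ξ .minus φ)) A =
      smoothAct (fun φ => V φ (ξ .plus φ)) A - smoothAct (fun φ => V φ (ξ .minus φ)) A := by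
    funext φ
    simp only [smoothAct, map_sub, Pi.sub_apply]
  rw [hsub]
  exact bracketOpp_eq_smoothAct_sub hV h𝒢 htime hA hB hq hs (s' := fun σ φ => V φ (ξ σ φ))
    fun σ => (hξ σ).isFluctuation_ofSmooth hV

end Reciprocity

section ParametricIntegrals

theorem fderiv_fst_eq_zero_of_eqOn_zero {E G N : Type*} [NormedAddCommGroup E] [NormedSpace ℝ E]
    [NormedAddCommGroup G] [NormedSpace ℝ G] {g : E × N → G} {O : Set E} {s₀ : E} {K : Set N}
    (hO : IsOpen O) (h0 : ∀ s ∈ O, ∀ x ∉ K, g (s, x) = 0) (hs₀ : s₀ ∈ O) {x : N} (hx : x ∉ K) :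
    fderiv ℝ (fun s => g (s, x)) s₀ = 0 := by
  have h : (fun s => g (s, x)) =ᶠ[𝓝 s₀] fun _ => 0 := by
    filter_upwards [hO.mem_nhds hs₀] with s hs using h0 s hs x hx
  rw [h.fderiv_eq, fderiv_const_apply]

theorem integrable_of_continuousOn_prod {P M G : Type*} [TopologicalSpace P] [TopologicalSpace M]
    [R1Space M] [MeasurableSpace M] [OpensMeasurableSpace M] {μ : Measure M}
    [IsFiniteMeasureOnCompacts μ] [NormedAddCommGroup G] {g : P × M → G} {O : Set P} {K : Set M}
    {s₀ : P} (hg : ContinuousOn g (O ×ˢ univ)) (hK : IsCompact K) (h0 : ∀ x ∉ K, g (s₀, x) = 0)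
    (hs₀ : s₀ ∈ O) :
    Integrable (fun x => g (s₀, x)) μ :=
  (hg.comp_continuous (f := fun x => (s₀, x)) (by fun_prop)
    fun x => ⟨hs₀, mem_univ x⟩).integrable_of_hasCompactSupport (HasCompactSupport.intro hK h0)

variable {E E' G : Type*} [NormedAddCommGroup E] [NormedSpace ℝ E] [NormedAddCommGroup E']
  [NormedSpace ℝ E'] [NormedAddCommGroup G] [NormedSpace ℝ G] {H : Type*} [TopologicalSpace H]
  {I : ModelWithCorners ℝ E' H} {M : Type*} [TopologicalSpace M] [ChartedSpace H M]
  {g : E × M → G} {O : Set E} {s₀ : E}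

theorem differentiableAt_fst_of_contMDiffOn (hO : IsOpen O)
    (hg : ContMDiffOn (𝓘(ℝ, E).prod I) 𝓘(ℝ, G) 1 g (O ×ˢ univ)) (hs₀ : s₀ ∈ O) (x : M) :
    DifferentiableAt ℝ (fun s => g (s, x)) s₀ := by
  have hgs : ContMDiffAt (𝓘(ℝ, E).prod I) 𝓘(ℝ, G) 1 g (s₀, x) :=
    hg.contMDiffAt ((hO.prod isOpen_univ).mem_nhds ⟨hs₀, mem_univ x⟩)
  have h : ContMDiffAt 𝓘(ℝ, E) 𝓘(ℝ, G) 1 (fun s => g (s, x)) s₀ :=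
    hgs.comp s₀ (contMDiffAt_id.prodMk contMDiffAt_const)
  exact h.contDiffAt.differentiableAt one_ne_zero

theorem continuousOn_fderiv_fst_of_contMDiffOn [IsManifold I 1 M] (hO : IsOpen O)
    (hg : ContMDiffOn (𝓘(ℝ, E).prod I) 𝓘(ℝ, G) 1 g (O ×ˢ univ)) :
    ContinuousOn (fun q : E × M => fderiv ℝ (fun s => g (s, q.2)) q.1) (O ×ˢ univ) := by
  rintro ⟨s, x⟩ hq
  refine ContinuousAt.continuousWithinAt ?_
  have hgq : ContMDiffAt (𝓘(ℝ, E).prod I) 𝓘(ℝ, G) 1 g (s, x) :=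
    hg.contMDiffAt ((hO.prod isOpen_univ).mem_nhds hq)
  have h := ContMDiffAt.mfderiv (J := 𝓘(ℝ, E).prod I) (I := 𝓘(ℝ, E)) (I' := 𝓘(ℝ, G)) (m := 0)
    (n := 1) (x₀ := (s, x)) (fun (q : E × M) s' => g (s', q.2)) Prod.fst
    (ContMDiffAt.comp (I' := 𝓘(ℝ, E).prod I) ((s, x), s) (g := g)
      (f := fun r : (E × M) × E => (r.2, r.1.2)) hgq
      (contMDiffAt_snd.prodMk (contMDiffAt_snd.comp _ contMDiffAt_fst))) contMDiffAt_fst (by simp)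
  have hcoord := (inTangentCoordinates_model_space (I := 𝓘(ℝ, E)) (I' := 𝓘(ℝ, G))
    (Prod.fst : E × M → _) (fun q => g (q.1, q.2))
    (fun q => mfderiv 𝓘(ℝ, E) 𝓘(ℝ, G) (fun s' => g (s', q.2)) q.1) (s, x)).symm
  simpa only [mfderiv_eq_fderiv] using (h.congr_of_eventuallyEq (.of_eq hcoord)).continuousAt

variable [MeasurableSpace M] [OpensMeasurableSpace M] {μ : Measure M}
  [IsFiniteMeasureOnCompacts μ] [IsManifold I 1 M] {K : Set M}

theorem integrable_fderiv_fst_of_contMDiffOn [R1Space M] (hO : IsOpen O)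
    (hg : ContMDiffOn (𝓘(ℝ, E).prod I) 𝓘(ℝ, G) 1 g (O ×ˢ univ)) (hK : IsCompact K)
    (h0 : ∀ s ∈ O, ∀ x ∉ K, g (s, x) = 0) (hs₀ : s₀ ∈ O) :
    Integrable (fun x => fderiv ℝ (fun s => g (s, x)) s₀) μ :=
  integrable_of_continuousOn_prod (continuousOn_fderiv_fst_of_contMDiffOn hO hg) hK
    (fun _ hx => fderiv_fst_eq_zero_of_eqOn_zero hO h0 hs₀ hx) hs₀

theorem hasFDerivAt_integral_of_contMDiffOn [T2Space M] [ProperSpace E] (hO : IsOpen O)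
    (hg : ContMDiffOn (𝓘(ℝ, E).prod I) 𝓘(ℝ, G) 1 g (O ×ˢ univ)) (hK : IsCompact K)
    (h0 : ∀ s ∈ O, ∀ x ∉ K, g (s, x) = 0) (hs₀ : s₀ ∈ O) :
    HasFDerivAt (fun s => ∫ x, g (s, x) ∂μ) (∫ x, fderiv ℝ (fun s => g (s, x)) s₀ ∂μ) s₀ := by
  obtain ⟨r, hr, hrO⟩ := Metric.nhds_basis_closedBall.mem_iff.1 (hO.mem_nhds hs₀)
  obtain ⟨C, hC⟩ := ((isCompact_closedBall s₀ r).prod hK).exists_bound_of_continuousOn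
    ((continuousOn_fderiv_fst_of_contMDiffOn hO hg).mono (prod_mono hrO (subset_univ K)))
  have hint : ∀ s ∈ O, Integrable (fun x => g (s, x)) μ := fun s hs =>
    integrable_of_continuousOn_prod hg.continuousOn hK (h0 s hs) hs
  refine hasFDerivAt_integral_of_dominated_of_fderiv_le (s := Metric.closedBall s₀ r)
    (F' := fun s x => fderiv ℝ (fun s => g (s, x)) s) (bound := K.indicator fun _ => C)
    (Metric.closedBall_mem_nhds s₀ hr) ?_ (hint s₀ hs₀)
    (integrable_fderiv_fst_of_contMDiffOn hO hg hK h0 hs₀).aestronglyMeasurable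
    (.of_forall fun x s hs => ?_)
    ((integrable_indicator_iff hK.measurableSet).2 (integrableOn_const hK.measure_lt_top.ne))
    (.of_forall fun x s hs => (differentiableAt_fst_of_contMDiffOn hO hg (hrO hs) x).hasFDerivAt)
  · filter_upwards [hO.mem_nhds hs₀] with s hs using (hint s hs).aestronglyMeasurable
  · by_cases hx : x ∈ K
    · rw [indicator_of_mem hx]
      exact hC (s, x) ⟨hs, hx⟩
    · rw [indicator_of_notMem hx, fderiv_fst_eq_zero_of_eqOn_zero hO h0 (hrO hs) hx, norm_zero]

end ParametricIntegrals

section PartialDerivatives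

variable {ι G : Type*} [Fintype ι] [NormedAddCommGroup G] [NormedSpace ℝ G]
  {f : EuclideanSpace ℝ ι → G} {q : EuclideanSpace ℝ ι}

theorem hasFDerivAt_of_hasLineDerivAt_single [DecidableEq ι] {c : ι → G}
    (hf : DifferentiableAt ℝ f q)
    (hc : ∀ i, HasLineDerivAt ℝ f (c i) q (EuclideanSpace.single i 1)) :
    HasFDerivAt f
      (∑ i, (EuclideanSpace.proj i : EuclideanSpace ℝ ι →L[ℝ] ℝ).smulRight (c i)) q := by
  convert hf.hasFDerivAt using 1
  refine ContinuousLinearMap.coe_injective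
    ((EuclideanSpace.basisFun ι ℝ).toBasis.ext fun i => ?_)
  have hi := (hf.hasFDerivAt.hasLineDerivAt (EuclideanSpace.single i 1)).unique (hc i)
  simp [hi]

/-- Schwarz's theorem: `c i` are the first and `h i j` the second partial derivatives of `f`. -/
theorem secondPartialDeriv_symm {c : ι → EuclideanSpace ℝ ι → G} {h : ι → ι → G}
    (hf : ∀ᶠ y in 𝓝 q, HasFDerivAt f
      (∑ i, (EuclideanSpace.proj i : EuclideanSpace ℝ ι →L[ℝ] ℝ).smulRight (c i y)) y)
    (hc : ∀ i, HasFDerivAt (c i)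
      (∑ j, (EuclideanSpace.proj j : EuclideanSpace ℝ ι →L[ℝ] ℝ).smulRight (h i j)) q) (i j : ι) :
    h i j = h j i := by
  classical
  have hf' := HasFDerivAt.fun_sum (u := Finset.univ) fun i _ =>
    (ContinuousLinearMap.smulRightL ℝ (EuclideanSpace ℝ ι) G
      (EuclideanSpace.proj i)).hasFDerivAt.comp q (hc i)
  have hsymm := second_derivative_symmetric_of_eventually hf hf' (EuclideanSpace.single j 1)
    (EuclideanSpace.single i 1)
  simpa using hsymm

end PartialDerivatives

section AffineFamilies

variable {d : ℕ} {M : Type u} [TopologicalSpace M] [ChartedSpace (EuclideanSpace ℝ (Fin d)) M]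
  {W : VBundle.{u, v, w} d M} {p : ℕ}

/-- The affine family of sections through `φ` with directions `s i`. The parameter space is
Euclidean because locality (`IsLocalOfOrder`) is tested on such families. -/
noncomputable def affineFamily (φ : W.Γ) (s : Fin p → W.Γ) (q : EuclideanSpace ℝ (Fin p)) : W.Γ :=
  φ + ∑ i, q i • s i

theorem affineFamily_apply (φ : W.Γ) (s : Fin p → W.Γ) (q : EuclideanSpace ℝ (Fin p)) (x : M) :
    affineFamily φ s q x = φ x + ∑ i, q i • s i x := by
  have hsum : (∑ i, q i • s i : W.Γ) x = ∑ i, (q i • s i) x := by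
    rw [← Finset.sum_apply]
    exact congrFun
      (map_sum (ContMDiffSection.coeAddHom (𝓡 d) W.F ∞ W.V) (fun i => q i • s i) _) x
  exact congrArg (φ x + ·) hsum

theorem affineFamily_zero (φ : W.Γ) (s : Fin p → W.Γ) : affineFamily φ s 0 = φ := by
  simp [affineFamily]

theorem affineFamily_add_smul_single (φ : W.Γ) (s : Fin p → W.Γ) (q : EuclideanSpace ℝ (Fin p))
    (ε : ℝ) (i : Fin p) :
    affineFamily φ s (q + ε • EuclideanSpace.single i 1) = affineFamily φ s q + ε • s i := by
  simp [affineFamily, add_smul, Finset.sum_add_distrib, add_assoc]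

theorem affineFamily_apply_of_notMem_supp {φ : W.Γ} {s : Fin p → W.Γ} {x : M}
    (hx : x ∉ ⋃ i, VBundle.supp (s i)) (q : EuclideanSpace ℝ (Fin p)) :
    affineFamily φ s q x = φ x := by
  have hs : ∀ i, s i x = 0 := fun i =>
    VBundle.eq_zero_of_notMem_supp fun h => hx (mem_iUnion.2 ⟨i, h⟩)
  simp [affineFamily_apply, hs]

theorem affineFamily_contMDiff (φ : W.Γ) (s : Fin p → W.Γ) :
    ContMDiff ((𝓡 p).prod (𝓡 d)) ((𝓡 d).prod 𝓘(ℝ, W.F)) ∞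
      (fun q : EuclideanSpace ℝ (Fin p) × M =>
        TotalSpace.mk' W.F q.2 (affineFamily φ s q.1 q.2)) := by
  rintro ⟨q₀, x₀⟩
  rw [contMDiffAt_totalSpace]
  refine ⟨contMDiffAt_snd, ?_⟩
  set e := trivializationAt W.F W.V x₀
  have hsection (t : W.Γ) : ContMDiffAt ((𝓡 p).prod (𝓡 d)) 𝓘(ℝ, W.F) ∞
      (fun q : EuclideanSpace ℝ (Fin p) × M => (e ⟨q.2, t q.2⟩).2) (q₀, x₀) :=
    ContMDiffAt.comp (q₀, x₀) (I' := 𝓡 d) (g := fun x => (e ⟨x, t x⟩).2)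
      (contMDiffAt_totalSpace.1 (t.contMDiff x₀)).2 contMDiffAt_snd
  have hcoord (i : Fin p) : ContMDiffAt ((𝓡 p).prod (𝓡 d)) 𝓘(ℝ, ℝ) ∞
      (fun q : EuclideanSpace ℝ (Fin p) × M => q.1 i) (q₀, x₀) :=
    ContMDiffAt.comp (q₀, x₀) (I' := 𝓡 p)
      (EuclideanSpace.proj (𝕜 := ℝ) i).contMDiff.contMDiffAt contMDiffAt_fst
  have hsum : ContMDiffAt ((𝓡 p).prod (𝓡 d)) 𝓘(ℝ, W.F) ∞
      (fun q : EuclideanSpace ℝ (Fin p) × M =>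
        (e ⟨q.2, φ q.2⟩).2 + ∑ i, q.1 i • (e ⟨q.2, s i q.2⟩).2) (q₀, x₀) :=
    (hsection φ).add (contMDiffAt_finsetSum fun i _ => (hcoord i).smul (hsection (s i)))
  refine hsum.congr_of_eventuallyEq ?_
  have hbase : ∀ᶠ q : EuclideanSpace ℝ (Fin p) × M in 𝓝 (q₀, x₀), q.2 ∈ e.baseSet :=
    continuousAt_snd.eventually_mem
      (e.open_baseSet.mem_nhds (FiberBundle.mem_baseSet_trivializationAt' x₀))
  filter_upwards [hbase] with q hq
  have hlinear (z : W.V q.2) : (e ⟨q.2, z⟩).2 = e.linearMapAt ℝ q.2 z := by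
    rw [e.coe_linearMapAt_of_mem hq]
  simp only [hlinear, affineFamily_apply, map_add, map_sum, map_smul]

variable {U : Set (TotalSpace W.F W.V)} {φ : W.Γ} {s : Fin p → W.Γ}

theorem isOpen_affineFamily_preimage_configurations (hU : IsOpen U) (hs : ∀ i, s i ∈ Γ₀ W) :
    IsOpen (affineFamily φ s ⁻¹' Configurations U) := by
  refine isOpen_iff_mem_nhds.2 fun q₀ hq₀ => ?_
  have hopen := hU.preimage (affineFamily_contMDiff φ s).continuous
  obtain ⟨O, O', hO, -, hqO, hKO', hOU⟩ := generalized_tube_lemma (isCompact_singleton (x := q₀))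
    (isCompact_iUnion hs) hopen (by rintro ⟨q, x⟩ ⟨rfl, -⟩; exact hq₀ x)
  filter_upwards [hO.mem_nhds (hqO rfl)] with q hq x
  by_cases hx : x ∈ ⋃ i, VBundle.supp (s i)
  · exact hOU (mk_mem_prod hq (hKO' hx))
  · rw [affineFamily_apply_of_notMem_supp hx, ← affineFamily_apply_of_notMem_supp hx q₀]
    exact hq₀ x

theorem IsLocalOfOrder.contMDiffOn_affineFamily {k : ℕ} {f : W.Γ → M → ℝ}
    (hf : IsLocalOfOrder U k f) (hU : IsOpen U) (hs : ∀ i, s i ∈ Γ₀ W) :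
    ContMDiffOn ((𝓡 p).prod (𝓡 d)) 𝓘(ℝ, ℝ) ∞
      (fun q : EuclideanSpace ℝ (Fin p) × M => f (affineFamily φ s q.1) q.2)
      ((affineFamily φ s ⁻¹' Configurations U) ×ˢ univ) :=
  hf.2 p _ _ (isOpen_affineFamily_preimage_configurations hU hs) (fun _ hq => hq)
    (affineFamily_contMDiff φ s).contMDiffOn

theorem IsLocalOfOrder.contMDiffOn_affineFamily_sub {k : ℕ} {f : W.Γ → M → ℝ}
    (hf : IsLocalOfOrder U k f) (hU : IsOpen U) (hs : ∀ i, s i ∈ Γ₀ W)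
    (hφ : φ ∈ Configurations U) :
    ContMDiffOn ((𝓡 p).prod (𝓡 d)) 𝓘(ℝ, ℝ) ∞
      (fun q : EuclideanSpace ℝ (Fin p) × M => f (affineFamily φ s q.1) q.2 - f φ q.2)
      ((affineFamily φ s ⁻¹' Configurations U) ×ˢ univ) := by
  have h := hf.contMDiffOn_affineFamily (φ := φ) hU hs
  have hbase : ContMDiffOn ((𝓡 p).prod (𝓡 d)) ((𝓡 p).prod (𝓡 d)) ∞
      (fun q : EuclideanSpace ℝ (Fin p) × M => ((0 : EuclideanSpace ℝ (Fin p)), q.2))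
      ((affineFamily φ s ⁻¹' Configurations U) ×ˢ univ) :=
    contMDiffOn_const.prodMk contMDiffOn_snd
  have hzero : affineFamily φ s 0 ∈ Configurations U := by rwa [affineFamily_zero]
  have hφ' : ContMDiffOn ((𝓡 p).prod (𝓡 d)) 𝓘(ℝ, ℝ) ∞
      (fun q : EuclideanSpace ℝ (Fin p) × M => f φ q.2)
      ((affineFamily φ s ⁻¹' Configurations U) ×ˢ univ) := by
    simpa only [Function.comp_def, affineFamily_zero] using
      h.comp hbase fun q _ => mk_mem_prod hzero (mem_univ q.2)
  exact h.sub hφ'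

theorem IsLocalOfOrder.affineFamily_sub_eq_zero [T2Space M] [IsManifold (𝓡 d) ∞ M] {k : ℕ}
    {f : W.Γ → M → ℝ} (hf : IsLocalOfOrder U k f) (hφ : φ ∈ Configurations U)
    {q : EuclideanSpace ℝ (Fin p)} (hq : affineFamily φ s q ∈ Configurations U) {x : M}
    (hx : x ∉ ⋃ i, VBundle.supp (s i)) : f (affineFamily φ s q) x - f φ x = 0 := by
  refine sub_eq_zero.2 (hf.1 _ hq _ hφ x (SameJet.of_eventuallyEq k ?_))
  have hclosed : IsClosed (⋃ i, VBundle.supp (s i)) :=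
    isClosed_iUnion_of_finite fun i => VBundle.isClosed_supp (s i)
  filter_upwards [hclosed.isOpen_compl.mem_nhds hx] with y hy
  exact affineFamily_apply_of_notMem_supp hy q

end AffineFamilies

section Lagrangian

variable {d : ℕ} {M : Type u} [TopologicalSpace M] [ChartedSpace (EuclideanSpace ℝ (Fin d)) M]
  [T2Space M] [IsManifold (𝓡 d) ∞ M] [MeasurableSpace M] [BorelSpace M]
  {W D : VBundle.{u, v, w} d M} {μ : Measure M} [IsLocallyFiniteMeasure μ] {p : ℕ}

theorem FieldEquations.hasFDerivAt_contraction_affineFamily (𝒯 : FieldEquations μ W D) {φ : W.Γ}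
    (hφ : φ ∈ Configurations 𝒯.U) {s : Fin p → W.Γ} (hs : ∀ i, s i ∈ Γ₀ W) {ξ : D.Γ}
    (hξ : ξ ∈ Γ₀ D) :
    HasFDerivAt (fun q => contraction μ (𝒯.T (affineFamily φ s q)) ξ)
      (∑ i, (EuclideanSpace.proj i : EuclideanSpace ℝ (Fin p) →L[ℝ] ℝ).smulRight
        (contraction μ (𝒯.J φ (s i)) ξ)) 0 := by
  obtain ⟨k, hk⟩ := 𝒯.isLocal_T
  have hO := isOpen_affineFamily_preimage_configurations (φ := φ) 𝒯.isOpen_U hs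
  have h0 : 0 ∈ affineFamily φ s ⁻¹' Configurations 𝒯.U := by rwa [mem_preimage, affineFamily_zero]
  have hg := ((hk ξ).contMDiffOn_affineFamily (φ := φ) 𝒯.isOpen_U hs).of_le
    (show (1 : WithTop ℕ∞) ≤ ∞ by simp)
  have hsupp : ∀ q ∈ affineFamily φ s ⁻¹' Configurations 𝒯.U, ∀ x ∉ VBundle.supp ξ,
      pairing (𝒯.T (affineFamily φ s q)) ξ x = 0 := fun q _ x hx =>
    pairing_eq_zero_of_right (VBundle.eq_zero_of_notMem_supp hx) _
  have hderiv := hasFDerivAt_integral_of_contMDiffOn (μ := μ) hO hg hξ hsupp h0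
  refine hasFDerivAt_of_hasLineDerivAt_single hderiv.differentiableAt fun i => ?_
  have hpointwise (x : M) : fderiv ℝ (fun q => pairing (𝒯.T (affineFamily φ s q)) ξ x) 0
      (EuclideanSpace.single i 1) = pairing (𝒯.J φ (s i)) ξ x := by
    refine ((differentiableAt_fst_of_contMDiffOn hO hg h0 x).hasFDerivAt.hasLineDerivAt _).unique ?_
    simpa only [HasLineDerivAt, affineFamily_add_smul_single, affineFamily_zero] using
      𝒯.linearization φ hφ (s i) (hs i) ξ x
  refine HasDerivAt.congr_deriv (hderiv.hasLineDerivAt (EuclideanSpace.single i 1)) ?_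
  rw [ContinuousLinearMap.integral_apply
    (integrable_fderiv_fst_of_contMDiffOn hO hg hξ hsupp h0)]
  exact integral_congr_ae (.of_forall hpointwise)

theorem IsLocalOfOrder.hasFDerivAt_integral_affineFamily_sub {U : Set (TotalSpace W.F W.V)} {k : ℕ}
    {ℓ : W.Γ → M → ℝ} (hℓ : IsLocalOfOrder U k ℓ) (hU : IsOpen U) {τ : W.Γ → W.dual.Γ}
    (hτ : ∀ φ ∈ Configurations U, ∀ s ∈ Γ₀ W,
      HasDerivAt (fun ε : ℝ => ∫ x, (ℓ (φ + ε • s) x - ℓ φ x) ∂μ) (contraction μ (τ φ) s) 0)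
    {φ : W.Γ} (hφ : φ ∈ Configurations U) {s : Fin p → W.Γ} (hs : ∀ i, s i ∈ Γ₀ W)
    {q : EuclideanSpace ℝ (Fin p)} (hq : affineFamily φ s q ∈ Configurations U) :
    HasFDerivAt (fun q => ∫ x, (ℓ (affineFamily φ s q) x - ℓ φ x) ∂μ)
      (∑ i, (EuclideanSpace.proj i : EuclideanSpace ℝ (Fin p) →L[ℝ] ℝ).smulRight
        (contraction μ (τ (affineFamily φ s q)) (s i))) q := by
  have hO := isOpen_affineFamily_preimage_configurations (φ := φ) hU hs
  have hg := (hℓ.contMDiffOn_affineFamily_sub hU hs hφ).of_le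
    (show (1 : WithTop ℕ∞) ≤ ∞ by simp)
  have hK : IsCompact (⋃ i, VBundle.supp (s i)) := isCompact_iUnion hs
  have hsupp : ∀ r ∈ affineFamily φ s ⁻¹' Configurations U, ∀ x ∉ ⋃ i, VBundle.supp (s i),
      ℓ (affineFamily φ s r) x - ℓ φ x = 0 := fun r hr x => hℓ.affineFamily_sub_eq_zero hφ hr
  have hint : ∀ r ∈ affineFamily φ s ⁻¹' Configurations U,
      Integrable (fun x => ℓ (affineFamily φ s r) x - ℓ φ x) μ := fun r hr =>
    integrable_of_continuousOn_prod hg.continuousOn hK (hsupp r hr) hr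
  refine hasFDerivAt_of_hasLineDerivAt_single
    (hasFDerivAt_integral_of_contMDiffOn hO hg hK hsupp hq).differentiableAt fun i => ?_
  have hline : ContinuousAt (fun ε : ℝ => q + ε • EuclideanSpace.single i (1 : ℝ)) 0 := by fun_prop
  refine ((hτ _ hq (s i) (hs i)).const_add (∫ x, (ℓ (affineFamily φ s q) x - ℓ φ x) ∂μ)
    ).congr_of_eventuallyEq ?_
  filter_upwards [hline.eventually_mem (hO.mem_nhds (by simpa using hq))] with ε hε
  rw [← sub_eq_iff_eq_add', ← integral_sub (hint _ hε) (hint q hq)]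
  simp only [affineFamily_add_smul_single, sub_sub_sub_cancel_right]

theorem FieldEquations.IsLagrangian.contraction_J_comm {𝒯 : FieldEquations μ W W}
    (h𝒯 : 𝒯.IsLagrangian) {φ : W.Γ} (hφ : φ ∈ Configurations 𝒯.U) {s t : W.Γ} (hs : s ∈ Γ₀ W)
    (ht : t ∈ Γ₀ W) : contraction μ (𝒯.J φ s) t = contraction μ (𝒯.J φ t) s := by
  obtain ⟨ℓ, k, hℓ, hS⟩ := h𝒯
  have hst : ∀ i, ![s, t] i ∈ Γ₀ W := Fin.forall_fin_two.2 ⟨hs, ht⟩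
  have hnear : ∀ᶠ q in 𝓝 0, affineFamily φ ![s, t] q ∈ Configurations 𝒯.U :=
    (isOpen_affineFamily_preimage_configurations 𝒯.isOpen_U hst).mem_nhds
      (by rwa [mem_preimage, affineFamily_zero])
  exact secondPartialDeriv_symm
    (hnear.mono fun _ => hℓ.hasFDerivAt_integral_affineFamily_sub 𝒯.isOpen_U hS hφ hst)
    (fun i => 𝒯.hasFDerivAt_contraction_affineFamily hφ hst (hst i)) 1 0

variable [μ.IsOpenPosMeasure]

theorem FieldEquations.IsLagrangian.J_eq_Jt {𝒯 : FieldEquations μ W W} (h𝒯 : 𝒯.IsLagrangian)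
    {φ : W.Γ} (hφ : φ ∈ Configurations 𝒯.U) (ξ : W.Γ) : 𝒯.J φ ξ = 𝒯.Jt φ ξ :=
  dual_ext_of_contraction (μ := μ) fun s hs => calc
    contraction μ (𝒯.J φ ξ) s = contraction μ (𝒯.J φ s) ξ :=
      contraction_adjoint_of_right (fun _ hs _ ht => h𝒯.contraction_J_comm hφ hs ht) ξ hs
    _ = contraction μ (𝒯.Jt φ ξ) s := contraction_adjoint_of_left (𝒯.adjoint φ hφ) hs ξ

theorem FieldEquations.IsLagrangian.isLagrangeAnchor_id {𝒯 : FieldEquations μ W W}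
    (h𝒯 : 𝒯.IsLagrangian) :
    IsLagrangeAnchor 𝒯 (fun _ => DiffOp.id W) (fun _ => DiffOp.id W.dual) :=
  ⟨fun _ _ _ _ _ _ => rfl, fun _ hφ ξ => h𝒯.J_eq_Jt hφ.1 ξ⟩

end Lagrangian

section Green

variable {d : ℕ} {M : Type u} [TopologicalSpace M] [ChartedSpace (EuclideanSpace ℝ (Fin d)) M]
  [MeasurableSpace M] {W : VBundle.{u, v, w} d M} {μ : Measure M} {𝒯 : FieldEquations μ W W}
  {time : M → ℝ} {σ : Dir} {A : CompactFunctional 𝒯} {B : RegularFunctional 𝒯} {φ : W.Γ}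
  {q : W.Γ → Distr W.dual} {s s' : W.Γ → W.Γ} {G : Dir → W.Γ → Γ₀ W.dual →ₗ[ℝ] W.Γ}
  [T2Space M] [IsManifold (𝓡 d) ∞ M]

/-- `G^{+ij}` vanishes for `i` later than `j`, so it maps test sections to sections supported in
the past: the label `σ` refers to the support in the second argument. -/
theorem IsGreen.causalSupport (hG : IsGreen 𝒯 time G) (htime : Continuous time)
    (hφ : φ ∈ 𝒯.shell) (σ : Dir) (α : Γ₀ W.dual) :
    CausalSupport time σ.opp (VBundle.supp (G σ φ α)) := by
  obtain ⟨-, -, hspatial, htimes⟩ := hG φ hφ σ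
  have hα : CausalSupport time σ.opp (VBundle.supp (α : W.dual.Γ)) :=
    causalSupport_of_isCompact htime α.2 σ.opp
  cases σ with
  | plus => exact ⟨hspatial α, hα.2.imp (htimes α)⟩
  | minus => exact ⟨hspatial α, hα.2.imp (htimes α)⟩

variable [BorelSpace M] [IsLocallyFiniteMeasure μ] [μ.IsOpenPosMeasure]

theorem IsGreen.fluctuation_apply (hG : IsGreen 𝒯 time G)
    (h𝒯 : 𝒯.IsLagrangian) (htime : Continuous time)
    (hq : IsFluctuation 𝒯 (fun _ => DiffOp.id W) time σ A q) (hφ : φ ∈ 𝒯.shell)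
    (β : Γ₀ W.dual) : q φ β = A.δ φ (G σ φ β) :=
  hq.apply_eq hφ (hG.causalSupport htime hφ σ β) (by rw [← h𝒯.J_eq_Jt hφ.1, (hG φ hφ σ).2.1])

theorem IsGreen.isFluctuation (hG : IsGreen 𝒯 time G) (htime : Continuous time)
    (B : RegularFunctional 𝒯) (σ : Dir) :
    IsFluctuation 𝒯 (fun _ => DiffOp.id W) time σ B.toCompactFunctional
      fun φ => ofSmooth μ (G σ.opp φ (B.grad φ)) := by
  refine (isFluctuation_ofSmooth_iff (Vt := fun _ => DiffOp.id W.dual)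
    fun _ _ _ _ _ _ => rfl).2 fun φ hφ => ⟨?_, (hG φ hφ σ.opp).2.1 (B.grad φ)⟩
  simpa only [Dir.opp_opp] using hG.causalSupport htime hφ σ.opp (B.grad φ)

theorem IsGreen.eq_of_isFluctuation (hG : IsGreen 𝒯 time G) (h𝒯 : 𝒯.IsLagrangian)
    (htime : Continuous time)
    (hs : IsFluctuation 𝒯 (fun _ => DiffOp.id W) time σ A fun φ => ofSmooth μ (s φ))
    (hs' : IsFluctuation 𝒯 (fun _ => DiffOp.id W) time σ A fun φ => ofSmooth μ (s' φ))
    (hφ : φ ∈ 𝒯.shell) : s φ = s' φ :=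
  ofSmooth_injective (μ := μ) <| LinearMap.ext fun β =>
    (hG.fluctuation_apply h𝒯 htime hs hφ β).trans (hG.fluctuation_apply h𝒯 htime hs' hφ β).symm

theorem IsGreen.bracket_eq (hG : IsGreen 𝒯 time G) (h𝒯 : 𝒯.IsLagrangian) (htime : Continuous time)
    (hq : IsFluctuation 𝒯 (fun _ => DiffOp.id W) time σ A q)
    (hs : IsFluctuation 𝒯 (fun _ => DiffOp.id W) time σ B.toCompactFunctional
      fun φ => ofSmooth μ (s φ)) :
    𝒯.OnShellEq (bracket A q B s)
      fun φ => σ.sign * A.δ φ (G .plus φ (B.grad φ) - G .minus φ (B.grad φ)) := fun φ hφ => calc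
  q φ (B.grad φ) - A.δ φ (s φ) = A.δ φ (G σ φ (B.grad φ)) - A.δ φ (G σ.opp φ (B.grad φ)) := by
    rw [hG.fluctuation_apply h𝒯 htime hq hφ,
      hG.eq_of_isFluctuation h𝒯 htime hs (hG.isFluctuation htime B σ) hφ]
  _ = σ.sign * A.δ φ (G .plus φ (B.grad φ) - G .minus φ (B.grad φ)) := by
    rw [map_sub, ← smul_eq_mul, σ.sign_smul_sub fun τ => A.δ φ (G τ φ (B.grad φ))]

end Green

theorem mainTheorem5_general {d : ℕ} {M : Type u} [TopologicalSpace M] [T2Space M]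
    [ChartedSpace (EuclideanSpace ℝ (Fin d)) M] [IsManifold (𝓡 d) ∞ M] [MeasurableSpace M]
    [BorelSpace M] (time : M → ℝ) (htime : Continuous time) (μ : Measure M)
    [IsLocallyFiniteMeasure μ] [μ.IsOpenPosMeasure] (W D F H : VBundle.{u, v, w} d M) :
    (∀ (𝒯 : FieldEquations μ W D) (𝒢 : GaugeGenerators 𝒯 F H)
      (V : W.Γ → DiffOp D W) (Vt : W.Γ → DiffOp W.dual D.dual),
      IsLagrangeAnchor 𝒯 V Vt → 𝒢.IsAcyclic time →
      ∀ (A : CompactFunctional 𝒯) (B : RegularFunctional 𝒯),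
        𝒢.IsObservable A → 𝒢.IsObservable B.toCompactFunctional →
        (∀ σ, ∃ ζ, IsRepercussion 𝒯 time σ A ζ) ∧
        (∀ σ, ∃ ξ : W.Γ → D.Γ,
          IsRepercussion 𝒯 time σ B.toCompactFunctional fun φ => ofSmooth μ (ξ φ)) ∧
        (∀ σ ζ ζ', IsRepercussion 𝒯 time σ A ζ → IsRepercussion 𝒯 time σ A ζ' →
          ∀ φ ∈ 𝒯.shell, ∃ m : Distr H.dual, m.IsCausal time σ ∧
            ζ' φ - ζ φ = m ∘ₗ (𝒢.L φ).onCompact) ∧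
        (∀ (σ : Dir) (ξ ξ' : W.Γ → D.Γ),
          IsRepercussion 𝒯 time σ B.toCompactFunctional (fun φ => ofSmooth μ (ξ φ)) →
          IsRepercussion 𝒯 time σ B.toCompactFunctional (fun φ => ofSmooth μ (ξ' φ)) →
          ∀ φ ∈ 𝒯.shell, ∃ m : H.Γ, CausalSupport time σ (VBundle.supp m) ∧
            ξ' φ - ξ φ = 𝒢.Lt φ m) ∧
        (∀ σ ζ, IsRepercussion 𝒯 time σ A ζ →
          IsFluctuation 𝒯 V time σ A (anchored Vt ζ)) ∧
        (∀ (σ : Dir) (ξ : W.Γ → D.Γ),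
          IsRepercussion 𝒯 time σ B.toCompactFunctional (fun φ => ofSmooth μ (ξ φ)) →
          IsFluctuation 𝒯 V time σ B.toCompactFunctional fun φ => ofSmooth μ (V φ (ξ φ))) ∧
        ∀ (qA : Dir → W.Γ → Distr W.dual) (sB : Dir → W.Γ → W.Γ),
          (∀ σ, IsFluctuation 𝒯 V time σ A (qA σ)) →
          (∀ σ, IsFluctuation 𝒯 V time σ B.toCompactFunctional fun φ => ofSmooth μ (sB σ φ)) →
          𝒯.OnShellEq (distrAct (qA .minus) B) (smoothAct (sB .plus) A) ∧
          𝒯.OnShellEq (smoothAct (sB .minus) A) (distrAct (qA .plus) B) ∧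
          𝒯.OnShellEq (bracket A (qA .plus) B (sB .plus)) (bracketOpp A (qA .minus) B (sB .minus)) ∧
          𝒯.OnShellEq (bracket A (qA .plus) B (sB .plus)) (-bracket A (qA .minus) B (sB .minus)) ∧
          (∀ ζ : Dir → W.Γ → Distr D.dual, (∀ σ, IsRepercussion 𝒯 time σ A (ζ σ)) →
            ∀ σ, 𝒯.OnShellEq (bracket A (qA σ) B (sB σ))
              (σ.sign • distrAct (anchored Vt (ζ .plus - ζ .minus)) B)) ∧
          (∀ ξ : Dir → W.Γ → D.Γ,
            (∀ σ, IsRepercussion 𝒯 time σ B.toCompactFunctional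
              fun φ => ofSmooth μ (ξ σ φ)) →
            ∀ σ, 𝒯.OnShellEq (bracketOpp A (qA σ) B (sB σ))
              (σ.sign • smoothAct (fun φ => V φ (ξ .plus φ - ξ .minus φ)) A))) ∧
    (∀ 𝒯 : FieldEquations μ W W, 𝒯.IsLagrangian →
      IsLagrangeAnchor 𝒯 (fun _ => DiffOp.id W) (fun _ => DiffOp.id W.dual) ∧
      ∀ G : Dir → W.Γ → Γ₀ W.dual →ₗ[ℝ] W.Γ, IsGreen 𝒯 time G →
        (∀ (σ : Dir) (A : CompactFunctional 𝒯) (qA : W.Γ → Distr W.dual),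
          IsFluctuation 𝒯 (fun _ => DiffOp.id W) time σ A qA →
          ∀ φ ∈ 𝒯.shell, ∀ β : Γ₀ W.dual, qA φ β = A.δ φ (G σ φ β)) ∧
        (∀ (σ : Dir) (B : RegularFunctional 𝒯),
          IsFluctuation 𝒯 (fun _ => DiffOp.id W) time σ B.toCompactFunctional
            fun φ => ofSmooth μ (G σ.opp φ (B.grad φ))) ∧
        ∀ (σ : Dir) (A : CompactFunctional 𝒯) (B : RegularFunctional 𝒯)
          (qA : W.Γ → Distr W.dual) (sB : W.Γ → W.Γ),
          IsFluctuation 𝒯 (fun _ => DiffOp.id W) time σ A qA →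
          IsFluctuation 𝒯 (fun _ => DiffOp.id W) time σ B.toCompactFunctional
            (fun φ => ofSmooth μ (sB φ)) →
          𝒯.OnShellEq (bracket A qA B sB)
            (fun φ => σ.sign * A.δ φ (G .plus φ (B.grad φ) - G .minus φ (B.grad φ)))) := by
  refine ⟨fun 𝒯 𝒢 V Vt hV h𝒢 A B hA hB => ?_, fun 𝒯 h𝒯 => ⟨h𝒯.isLagrangeAnchor_id, fun G hG => ?_⟩⟩
  · refine ⟨hA.exists_isRepercussion h𝒢 htime, hB.exists_smooth_isRepercussion h𝒢 htime,
      fun σ ζ ζ' hζ hζ' φ hφ => hζ.exists_sub_eq h𝒢 hζ' hφ,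
      fun σ ξ ξ' hξ hξ' φ hφ => hξ.exists_smooth_sub_eq h𝒢 hξ' hφ,
      fun σ ζ hζ => hζ.isFluctuation_anchored hV,
      fun σ ξ hξ => hξ.isFluctuation_ofSmooth hV, fun qA sB hq hs => ?_⟩
    have hbracket := bracket_eq_bracketOpp hV h𝒢 htime hA hB hq hs .plus
    exact ⟨(hq .minus).reciprocity hV h𝒢 htime hA hB (hs .plus),
      ((hq .plus).reciprocity hV h𝒢 htime hA hB (hs .minus)).symm,
      hbracket, bracketOpp_eq_neg_bracket A (qA .minus) B (sB .minus) ▸ hbracket,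
      fun ζ hζ σ => IsRepercussion.bracket_eq hV h𝒢 htime hA hB (hq σ) (hs σ) hζ,
      fun ξ hξ σ => IsRepercussion.bracketOpp_eq hV h𝒢 htime hA hB (hq σ) (hs σ) hξ⟩
  · exact ⟨fun σ A qA hq φ hφ β => hG.fluctuation_apply h𝒯 htime hq hφ β,
      fun σ B => hG.isFluctuation htime B σ, fun σ A B qA sB hq hs => hG.bracket_eq h𝒯 htime hq hs⟩

theorem mainTheorem5 {n : ℕ} {M : Type u} [TopologicalSpace M] [T2Space M]
    [SecondCountableTopology M] [ChartedSpace (EuclideanSpace ℝ (Fin (n + 1))) M]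
    [IsManifold (𝓡 (n + 1)) ∞ M] [MeasurableSpace M] [BorelSpace M]
    {N : Type*} [TopologicalSpace N] [ChartedSpace (EuclideanSpace ℝ (Fin n)) N]
    [IsManifold (𝓡 n) ∞ N]
    (split : Diffeomorph (𝓡 (n + 1)) (𝓘(ℝ, ℝ).prod (𝓡 n)) M (ℝ × N) ∞)
    (time : M → ℝ) (htime : ∀ x, time x = (split x).1)
    (μ : Measure M) [IsLocallyFiniteMeasure μ] (hμ : IsSmoothVolume (n + 1) μ)
    (W D F H : VBundle.{u, v, w} (n + 1) M) :
    (∀ (𝒯 : FieldEquations μ W D) (𝒢 : GaugeGenerators 𝒯 F H)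
      (V : W.Γ → DiffOp D W) (Vt : W.Γ → DiffOp W.dual D.dual),
      IsLagrangeAnchor 𝒯 V Vt → 𝒢.IsAcyclic time →
      ∀ (A : CompactFunctional 𝒯) (B : RegularFunctional 𝒯),
        𝒢.IsObservable A → 𝒢.IsObservable B.toCompactFunctional →
        -- existence of repercussions
        (∀ σ, ∃ ζ, IsRepercussion 𝒯 time σ A ζ) ∧
        (∀ σ, ∃ ξ : W.Γ → D.Γ,
          IsRepercussion 𝒯 time σ B.toCompactFunctional fun φ => ofSmooth μ (ξ φ)) ∧
        -- uniqueness of repercussions modulo `Im L*`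
        (∀ σ ζ ζ', IsRepercussion 𝒯 time σ A ζ → IsRepercussion 𝒯 time σ A ζ' →
          ∀ φ ∈ 𝒯.shell, ∃ m : Distr H.dual, m.IsCausal time σ ∧
            ζ' φ - ζ φ = m ∘ₗ (𝒢.L φ).onCompact) ∧
        (∀ (σ : Dir) (ξ ξ' : W.Γ → D.Γ),
          IsRepercussion 𝒯 time σ B.toCompactFunctional (fun φ => ofSmooth μ (ξ φ)) →
          IsRepercussion 𝒯 time σ B.toCompactFunctional (fun φ => ofSmooth μ (ξ' φ)) →
          ∀ φ ∈ 𝒯.shell, ∃ m : H.Γ, CausalSupport time σ (VBundle.supp m) ∧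
            ξ' φ - ξ φ = 𝒢.Lt φ m) ∧
        -- `A_σ^a V_a` is a fluctuation caused by `A`
        (∀ σ ζ, IsRepercussion 𝒯 time σ A ζ →
          IsFluctuation 𝒯 V time σ A (anchored Vt ζ)) ∧
        (∀ (σ : Dir) (ξ : W.Γ → D.Γ),
          IsRepercussion 𝒯 time σ B.toCompactFunctional (fun φ => ofSmooth μ (ξ φ)) →
          IsFluctuation 𝒯 V time σ B.toCompactFunctional fun φ => ofSmooth μ (V φ (ξ φ))) ∧
        -- for arbitrary fluctuations `V_A^σ = qA σ` and `V_B^σ = sB σ`: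
        ∀ (qA : Dir → W.Γ → Distr W.dual) (sB : Dir → W.Γ → W.Γ),
          (∀ σ, IsFluctuation 𝒯 V time σ A (qA σ)) →
          (∀ σ, IsFluctuation 𝒯 V time σ B.toCompactFunctional fun φ => ofSmooth μ (sB σ φ)) →
          -- reciprocity `V_A^- B ≈ V_B^+ A` and `V_B^- A ≈ V_A^+ B`
          𝒯.OnShellEq (distrAct (qA .minus) B) (smoothAct (sB .plus) A) ∧
          𝒯.OnShellEq (smoothAct (sB .minus) A) (distrAct (qA .plus) B) ∧
          -- the brackets: `{A,B}^+ ≈ {B,A}^-` and `{A,B}^+ ≈ -{A,B}^-`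
          𝒯.OnShellEq (bracket A (qA .plus) B (sB .plus)) (bracketOpp A (qA .minus) B (sB .minus)) ∧
          𝒯.OnShellEq (bracket A (qA .plus) B (sB .plus)) (-bracket A (qA .minus) B (sB .minus)) ∧
          -- `{A,B}^σ ≈ σ (A_+ - A_-)^a V_a B` and `{B,A}^σ ≈ σ (B_+ - B_-)^a V_a A`
          (∀ ζ : Dir → W.Γ → Distr D.dual, (∀ σ, IsRepercussion 𝒯 time σ A (ζ σ)) →
            ∀ σ, 𝒯.OnShellEq (bracket A (qA σ) B (sB σ))
              (σ.sign • distrAct (anchored Vt (ζ .plus - ζ .minus)) B)) ∧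
          (∀ ξ : Dir → W.Γ → D.Γ,
            (∀ σ, IsRepercussion 𝒯 time σ B.toCompactFunctional
              fun φ => ofSmooth μ (ξ σ φ)) →
            ∀ σ, 𝒯.OnShellEq (bracketOpp A (qA σ) B (sB σ))
              (σ.sign • smoothAct (fun φ => V φ (ξ .plus φ - ξ .minus φ)) A))) ∧
    -- Lagrangian equations with the canonical Lagrange anchor `V = 1`
    (∀ 𝒯 : FieldEquations μ W W, 𝒯.IsLagrangian →
      IsLagrangeAnchor 𝒯 (fun _ => DiffOp.id W) (fun _ => DiffOp.id W.dual) ∧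
      ∀ G : Dir → W.Γ → Γ₀ W.dual →ₗ[ℝ] W.Γ, IsGreen 𝒯 time G →
        -- the fluctuations are given by the Green functions
        (∀ (σ : Dir) (A : CompactFunctional 𝒯) (qA : W.Γ → Distr W.dual),
          IsFluctuation 𝒯 (fun _ => DiffOp.id W) time σ A qA →
          ∀ φ ∈ 𝒯.shell, ∀ β : Γ₀ W.dual, qA φ β = A.δ φ (G σ φ β)) ∧
        (∀ (σ : Dir) (B : RegularFunctional 𝒯),
          IsFluctuation 𝒯 (fun _ => DiffOp.id W) time σ B.toCompactFunctional
            fun φ => ofSmooth μ (G σ.opp φ (B.grad φ))) ∧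
        -- Peierls' formula `{A,B}^σ ≈ σ A_{,i} (G^{+ij} - G^{-ij}) B_{,j}`
        ∀ (σ : Dir) (A : CompactFunctional 𝒯) (B : RegularFunctional 𝒯)
          (qA : W.Γ → Distr W.dual) (sB : W.Γ → W.Γ),
          IsFluctuation 𝒯 (fun _ => DiffOp.id W) time σ A qA →
          IsFluctuation 𝒯 (fun _ => DiffOp.id W) time σ B.toCompactFunctional
            (fun φ => ofSmooth μ (sB φ)) →
          𝒯.OnShellEq (bracket A qA B sB)
            (fun φ => σ.sign * A.δ φ (G .plus φ (B.grad φ) - G .minus φ (B.grad φ)))) := by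
  have := hμ.isOpenPosMeasure
  exact mainTheorem5_general time
    (by rw [funext htime]; exact continuous_fst.comp split.contMDiff_toFun.continuous) μ W D F H
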